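/- Let $M$ be a smooth 2-manifold, $T^1M$ its tangent bundle and $T^2M$ its manifold of second-order velocities. Every chart $(x,y)$ of $M$, together with the standard coordinate $t$ of $\mathbb{R}$, induces coordinates $(t,x,y,\dot x,\dot y)$ on $\mathbb{R}\times T^1M$ and $(t,x,y,\dot x,\dot y,\ddot x,\ddot y)$ on $\mathbb{R}\times T^2M$. Let $\varepsilon$ be a smooth source form on $\mathbb{R}\times T^2M$ that does not depend on $t$ explicitly, i.e. a 2-form which in every chart is $$\varepsilon=(\varepsilon_x\,\omega^x+\varepsilon_y\,\omega^y)\wedge dt,\qquad \omega^x=dx-\dot x\,dt,\quad \omega^y=dy-\dot y\,dt,$$ with $\varepsilon_x,\varepsilon_y$ smooth functions of $x,y,\dot x,\dot y,\ddot x,\ddot y$. Suppose that $\varepsilon$ is locally variational: over a chart neighbourhood of every point of $\mathbb{R}\times M$ there is a smooth function $\mathscr{L}(t,x,y,\dot x,\dot y)$ with $$\varepsilon_x=\frac{\partial\mathscr{L}}{\partial x}-\frac{d}{dt}\frac{\partial\mathscr{L}}{\partial\dot x},\qquad \varepsilon_y=\frac{\partial\mathscr{L}}{\partial y}-\frac{d}{dt}\frac{\partial\mathscr{L}}{\partial\dot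 y}.$$ Then $\varepsilon_x=A_x+B_{xx}\ddot x+B_{xy}\ddot y$ and $\varepsilon_y=A_y+B_{xy}\ddot x+B_{yy}\ddot y$ in every chart, with functions $A_x,A_y,B_{xx},B_{xy},B_{yy}$ of $x,y,\dot x,\dot y$. Suppose finally that in every chart $$\left(\frac{\partial A_x}{\partial\dot y}-\frac{\partial A_y}{\partial\dot x}\right)_{(x,y,0,0)}=0 .$$ Then: (1) $\varepsilon$ is globally variational: there is a smooth function $\mathscr{L}$ on the whole of $\mathbb{R}\times T^1M$ whose Euler–Lagrange expressions are $\varepsilon_x,\varepsilon_y$ in every chart. (2) There are smooth 1-forms $\mu_0$ and $\kappa$, defined on the whole of $\mathbb{R}\times T^1M$, which in every chart are $$\begin{aligned}\mu_0={}&-\left(A_x-\tfrac12\left(\tfrac{\partial A_x}{\partial\dot y}-\tfrac{\partial A_y}{\partial\dot x}\right)\dot y\right)t\,dx-\left(A_y-\tfrac12\left(\tfrac{\partial A_y}{\partial\dot x}-\tfrac{\partial A_x}{\partial\dot y}\right)\dot x\right)t\,dy\\&-(B_{xx}\dot x+B_{xy}\dot y)\,t\,d\dot x-(B_{xy}\dot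 x+B_{yy}\dot y)\,t\,d\dot y,\end{aligned}$$ $$\begin{aligned}\kappa={}&-\left(\int_0^{\dot x}B_{xx}(x,y,\nu,\dot y)\,d\nu+\int_0^{\dot y}B_{xy}(x,y,0,\sigma)\,d\sigma\right)dx\\&-\left(\int_0^{\dot x}B_{xy}(x,y,\nu,\dot y)\,d\nu+\int_0^{\dot y}B_{yy}(x,y,0,\sigma)\,d\sigma\right)dy,\end{aligned}$$ and $\lambda=h(\mu_0+\kappa)$ is a smooth global Lagrangian for $\varepsilon$ on $\mathbb{R}\times T^2M$. Here $h$ is the horizontalization, $h\,dt=dt$, $h\,dx=\dot x\,dt$, $h\,dy=\dot y\,dt$, $h\,d\dot x=\ddot x\,dt$, $h\,d\dot y=\ddot y\,dt$, and the claim means that, writing $\lambda=L\,dt$, in every chart $$\varepsilon_x=\frac{\partial L}{\partial x}-\frac{d}{dt}\frac{\partial L}{\partial\dot x}+\frac{d^2}{dt^2}\frac{\partial L}{\partial\ddot x},\qquad \varepsilon_y=\frac{\partial L}{\partial y}-\frac{d}{dt}\frac{\partial L}{\partial\dot y}+\frac{d^2}{dt^2}\frac{\partial L}{\partial\ddot y}.$$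 No hypothesis is made on the cohomology of $M$. -/

import Mathlib

open Set Bundle
open scoped Manifold ContDiff Topology

noncomputable section

namespace GlobalVar

/-- The coordinate plane; a point `x` has coordinates `x 0` and `x 1`
(the coordinates called `x` and `y` on a chart of a 2-manifold). -/
abbrev Plane : Type := EuclideanSpace ℝ (Fin 2)

/-- The coordinate vector `e i` of the plane. -/
def e (i : Fin 2) : Plane := EuclideanSpace.single i 1

section Spaces

variable (M : Type*) [TopologicalSpace M] [ChartedSpace Plane M]

/-- `T¹M`, the tangent bundle. -/
abbrev T1 : Type _ := TangentBundle (𝓡 2) M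

/-- `φ` is a chart of the smooth structure of the 2-manifold `M` (a member of the maximal atlas).
Together with the standard coordinate `t` it is a fibered chart of `ℝ × M`. -/
def IsChart (φ : OpenPartialHomeomorph M Plane) : Prop :=
  φ ∈ IsManifold.maximalAtlas (𝓡 2) ∞ M

variable [IsManifold (𝓡 2) ∞ M]

/-- `T²M`, the second-order velocities: the tangent vectors `w` of `T¹M`, at `v ∈ T¹M`, that satisfy
the second-order condition `Tπ(w) = v`, where `π : T¹M → M`.  The 2-jet at `0` of a curve `ζ` in `M`
is the velocity at `0` of the curve `s ↦ ζ'(s)` in `T¹M`. -/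
def T2 : Type _ :=
  {w : TangentBundle (𝓡 2).tangent (T1 M) //
    tangentMap (𝓡 2).tangent (𝓡 2) (TotalSpace.proj : T1 M → M) w = w.proj}

end Spaces

section Charts

variable {M : Type*} [TopologicalSpace M] [ChartedSpace Plane M]

/-- The inverse of the chart of `T¹M` associated with `φ`: the pair `(x, ẋ)` is sent to the tangent
vector `ẋ⁰ ∂/∂x⁰ + ẋ¹ ∂/∂x¹` at the point with coordinates `x`. -/
def chartT1 (φ : OpenPartialHomeomorph M Plane) (z : Plane × Plane) : T1 M :=
  ⟨φ.symm z.1, mfderiv (𝓡 2) (𝓡 2) φ.symm z.1 z.2⟩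

/-- The inverse of the chart of `ℝ × T¹M` associated with `φ`, in the coordinates `(t, x, ẋ)`. -/
def chartJ1 (φ : OpenPartialHomeomorph M Plane) (z : ℝ × Plane × Plane) : ℝ × T1 M :=
  (z.1, chartT1 φ z.2)

variable [IsManifold (𝓡 2) ∞ M]

theorem mdifferentiableAt_chartT1 {φ : OpenPartialHomeomorph M Plane} (hφ : IsChart M φ)
    {z : Plane × Plane} (hz : z.1 ∈ φ.target) :
    MDifferentiableAt 𝓘(ℝ, Plane × Plane) (𝓡 2).tangent (chartT1 φ) z := by
  have h1 : ContMDiffOn (𝓡 2) (𝓡 2) ∞ φ.symm φ.target :=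
    contMDiffOn_symm_of_mem_maximalAtlas hφ
  have h2 := h1.contMDiffOn_tangentMapWithin (m := 1) (by norm_cast)
    φ.open_target.uniqueMDiffOn
  have h3 : ContMDiff 𝓘(ℝ, Plane × Plane) (𝓡 2).tangent 1
      (fun z : Plane × Plane => (⟨z.1, z.2⟩ : TangentBundle (𝓡 2) Plane)) := by
    have := contMDiff_tangentBundleModelSpaceHomeomorph_symm (I := 𝓡 2) (n := 1)
    rw [modelWithCornersSelf_prod]
    exact this
  have h4 : ContMDiffAt 𝓘(ℝ, Plane × Plane) (𝓡 2).tangent 1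
      (fun z => tangentMapWithin (𝓡 2) (𝓡 2) φ.symm φ.target
        (⟨z.1, z.2⟩ : TangentBundle (𝓡 2) Plane)) z := by
    refine ContMDiffAt.comp z (h2.contMDiffAt ?_) h3.contMDiffAt
    refine (φ.open_target.preimage (FiberBundle.continuous_proj Plane
      (TangentSpace (𝓡 2) : Plane → Type _))).mem_nhds ?_
    exact hz
  refine (h4.congr_of_eventuallyEq ?_).mdifferentiableAt one_ne_zero
  filter_upwards [(φ.open_target.preimage continuous_fst).mem_nhds hz] with y hy
  simp only [tangentMapWithin, chartT1]
  rw [mfderivWithin_of_isOpen φ.open_target hy]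

theorem tangentMap_proj_chartT1 {φ : OpenPartialHomeomorph M Plane} (hφ : IsChart M φ)
    {z : Plane × Plane} (hz : z.1 ∈ φ.target) (a : Plane) :
    tangentMap (𝓡 2).tangent (𝓡 2) (TotalSpace.proj : T1 M → M)
      ⟨chartT1 φ z, mfderiv 𝓘(ℝ, Plane × Plane) (𝓡 2).tangent (chartT1 φ) z (z.2, a)⟩
      = chartT1 φ z := by
  have hp : MDifferentiableAt (𝓡 2).tangent (𝓡 2) (TotalSpace.proj : T1 M → M) (chartT1 φ z) :=
    (contMDiff_proj (TangentSpace (𝓡 2) : M → Type _) (n := 1)).mdifferentiableAt one_ne_zero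
  have hs : MDifferentiableAt (𝓡 2) (𝓡 2) φ.symm z.1 :=
    (contMDiffAt_symm_of_mem_maximalAtlas hφ hz).mdifferentiableAt (by simp)
  have hf : MDifferentiableAt 𝓘(ℝ, Plane × Plane) (𝓡 2) (Prod.fst : Plane × Plane → Plane) z :=
    differentiableAt_fst.mdifferentiableAt
  have k1 := mfderiv_comp z hp (mdifferentiableAt_chartT1 hφ hz)
  have k2 := mfderiv_comp z (I := 𝓘(ℝ, Plane × Plane)) (f := Prod.fst) hs hf
  have k3 : (TotalSpace.proj : T1 M → M) ∘ chartT1 φ = φ.symm ∘ Prod.fst := rfl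
  have k4 : mfderiv 𝓘(ℝ, Plane × Plane) (𝓡 2) (Prod.fst : Plane × Plane → Plane) z
      = ContinuousLinearMap.fst ℝ Plane Plane := by
    rw [mfderiv_eq_fderiv]; exact fderiv_fst
  rw [k3, k2, k4] at k1
  have k5 := congrArg (fun L => L (z.2, a)) k1
  refine TotalSpace.ext rfl ?_
  exact heq_of_eq k5.symm

/-- The inverse of the chart of `T²M` associated with `φ`: `(x, ẋ, ẍ)` is sent to the second-order
velocity with these coordinates. -/
def chartT2 {φ : OpenPartialHomeomorph M Plane} (hφ : IsChart M φ)
    (z : Plane × Plane × Plane) (hz : z.1 ∈ φ.target) : T2 M :=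
  ⟨⟨chartT1 φ (z.1, z.2.1),
      mfderiv 𝓘(ℝ, Plane × Plane) (𝓡 2).tangent (chartT1 φ) (z.1, z.2.1) (z.2.1, z.2.2)⟩,
    tangentMap_proj_chartT1 (z := (z.1, z.2.1)) hφ hz z.2.2⟩

end Charts

section Forms

variable {M : Type*} [TopologicalSpace M] [ChartedSpace Plane M] [IsManifold (𝓡 2) ∞ M]

/-- The point of `M` over which a second-order velocity lies. -/
def T2.base (j : T2 M) : M := j.1.proj.proj

/-- The chart expression `f(t, x, ẋ, ẍ)` of a function on `ℝ × T²M`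
(set to `0` for `x` outside the range of the chart). -/
def chartFun2 {φ : OpenPartialHomeomorph M Plane} (hφ : IsChart M φ) (f : ℝ × T2 M → ℝ)
    (z : ℝ × Plane × Plane × Plane) : ℝ :=
  open Classical in if hz : z.2.1 ∈ φ.target then f (z.1, chartT2 hφ z.2 hz) else 0

/-- The chart expression `f(t, x, ẋ)` of a function on `ℝ × T¹M`. -/
def chartFun1 (φ : OpenPartialHomeomorph M Plane) (f : ℝ × T1 M → ℝ)
    (z : ℝ × Plane × Plane) : ℝ :=
  f (chartJ1 φ z)

variable (M) in
/-- A (not necessarily smooth) 2-form on `J²(ℝ × M) = ℝ × T²M` that is horizontal over `ℝ × M`,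
given by an alternating 2-form on the tangent space `ℝ × T_q M` of `ℝ × M` at `(t, q)`, for every
point of `ℝ × T²M` over `(t, q)`. -/
abbrev HorizontalTwoForm : Type _ :=
  ∀ p : ℝ × T2 M, (ℝ × TangentSpace (𝓡 2) p.2.base) [⋀^Fin 2]→L[ℝ] ℝ

/-- The coefficient `ε_i(x, ẋ, ẍ)`, at `t = 0`, of `dxⁱ ∧ dt` in the chart expression of a horizontal
2-form: its value on the pair `(∂/∂xⁱ, ∂/∂t)`.  As `ωⁱ ∧ dt = dxⁱ ∧ dt` for `ωⁱ = dxⁱ - ẋⁱ dt`,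
a 1-contact and time-independent form is `(ε_0 ω⁰ + ε_1 ω¹) ∧ dt`. -/
def sourceCoeff (ε : HorizontalTwoForm M) {φ : OpenPartialHomeomorph M Plane} (hφ : IsChart M φ)
    (i : Fin 2) (z : Plane × Plane × Plane) : ℝ :=
  open Classical in
  if hz : z.1 ∈ φ.target then
    ε (0, chartT2 hφ z hz) ![(0, mfderiv (𝓡 2) (𝓡 2) φ.symm z.1 (e i)), (1, 0)]
  else 0

variable (M) in
/-- A smooth source form on `ℝ × T²M` that does not depend on the time explicitly. -/
structure SourceForm where
  /-- the underlying horizontal 2-form -/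
  form : HorizontalTwoForm M
  /-- There is no `ω⁰ ∧ ω¹` component: the form vanishes on pairs of vertical vectors. -/
  one_contact : ∀ (p : ℝ × T2 M) (u v : TangentSpace (𝓡 2) p.2.base),
    form p ![(0, u), (0, v)] = 0
  time_independent : ∀ (t t' : ℝ) (j : T2 M), form (t, j) = form (t', j)
  smooth : ∀ (φ : OpenPartialHomeomorph M Plane) (hφ : IsChart M φ) (i : Fin 2),
    ContDiffOn ℝ ∞ (sourceCoeff form hφ i) (φ.target ×ˢ univ)

namespace SourceForm

variable (ε : SourceForm M) {φ : OpenPartialHomeomorph M Plane} (hφ : IsChart M φ)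

/-- The chart coefficients `ε_i(x, ẋ, ẍ)`. -/
def coeff (i : Fin 2) (z : Plane × Plane × Plane) : ℝ := sourceCoeff ε.form hφ i z

/-- The coefficient `A_i(x, ẋ)` in `ε_i = A_i + B_{i0} ẍ⁰ + B_{i1} ẍ¹`. -/
def A (i : Fin 2) (z : Plane × Plane) : ℝ := ε.coeff hφ i (z.1, z.2, 0)

/-- The coefficient `B_{ij}(x, ẋ)` in `ε_i = A_i + B_{i0} ẍ⁰ + B_{i1} ẍ¹`. -/
def B (i j : Fin 2) (z : Plane × Plane) : ℝ :=
  fderiv ℝ (fun a : Plane => ε.coeff hφ i (z.1, z.2, a)) 0 (e j)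

/-- `∂A_i/∂ẋʲ`. -/
def dA (i j : Fin 2) (z : Plane × Plane) : ℝ :=
  fderiv ℝ (fun v : Plane => ε.A hφ i (z.1, v)) z.2 (e j)

end SourceForm

/-- The Euler–Lagrange expression `E_i(L) = ∂L/∂xⁱ - d/dt ∂L/∂ẋⁱ` of a first-order Lagrange
function `L(t, x, ẋ)`, as a function of `(t, x, ẋ, ẍ)`. -/
def eulerLagrange1 (L : ℝ × Plane × Plane → ℝ) (i : Fin 2) (z : ℝ × Plane × Plane × Plane) : ℝ :=
  let (t, x, v, a) := z
  fderiv ℝ L (t, x, v) (0, e i, 0)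
    - fderiv ℝ (fun y => fderiv ℝ L y (0, 0, e i)) (t, x, v) (1, v, a)

/-- The total derivative `d/dt` of a function of `(t, x, ẋ, ẍ)`, as a function of the third-order jet
`(t, x, ẋ, ẍ, x⁽³⁾)`. -/
def totalDeriv2 (f : ℝ × Plane × Plane × Plane → ℝ) (z : ℝ × Plane × Plane × Plane × Plane) : ℝ :=
  let (t, x, v, a, b) := z
  fderiv ℝ f (t, x, v, a) (1, v, a, b)

/-- The total derivative `d/dt` of a function of `(t, x, ẋ, ẍ, x⁽³⁾)`, as a function of the
fourth-order jet `(t, x, ẋ, ẍ, x⁽³⁾, x⁽⁴⁾)`. -/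
def totalDeriv3 (f : ℝ × Plane × Plane × Plane × Plane → ℝ)
    (z : ℝ × Plane × Plane × Plane × Plane × Plane) : ℝ :=
  let (t, x, v, a, b, c) := z
  fderiv ℝ f (t, x, v, a, b) (1, v, a, b, c)

/-- The Euler–Lagrange expression `E_i(L) = ∂L/∂xⁱ - d/dt ∂L/∂ẋⁱ + d²/dt² ∂L/∂ẍⁱ` of a second-order
Lagrange function `L(t, x, ẋ, ẍ)`, as a function of the fourth-order jet. -/
def eulerLagrange2 (L : ℝ × Plane × Plane × Plane → ℝ) (i : Fin 2)
    (z : ℝ × Plane × Plane × Plane × Plane × Plane) : ℝ :=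
  let (t, x, v, a, b, _) := z
  fderiv ℝ L (t, x, v, a) (0, e i, 0, 0)
    - totalDeriv2 (fun y => fderiv ℝ L y (0, 0, e i, 0)) (t, x, v, a, b)
    + totalDeriv3 (totalDeriv2 (fun y => fderiv ℝ L y (0, 0, 0, e i))) z

/-- Every point `(t₀, q)` of `ℝ × M` lies in a chart neighbourhood `J × U` over which the coefficients
of `ε` are the Euler–Lagrange expressions of a smooth Lagrange function `L(t, x, ẋ)`. -/
def SourceForm.LocallyVariational (ε : SourceForm M) : Prop :=
  ∀ (t₀ : ℝ) (q : M), ∃ (φ : OpenPartialHomeomorph M Plane) (hφ : IsChart M φ) (J : Set ℝ)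
    (L : ℝ × Plane × Plane → ℝ),
    q ∈ φ.source ∧ IsOpen J ∧ t₀ ∈ J ∧ ContDiffOn ℝ ∞ L (J ×ˢ φ.target ×ˢ univ) ∧
      ∀ t ∈ J, ∀ x ∈ φ.target, ∀ (v a : Plane) (i : Fin 2),
        ε.coeff hφ i (x, v, a) = eulerLagrange1 L i (t, x, v, a)

/-- There is a smooth first-order Lagrange function on the whole of `ℝ × T¹M` for `ε`. -/
def SourceForm.GloballyVariational (ε : SourceForm M) : Prop :=
  ∃ L : ℝ × T1 M → ℝ, ContMDiff (𝓘(ℝ, ℝ).prod (𝓡 2).tangent) 𝓘(ℝ, ℝ) ∞ L ∧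
    ∀ (φ : OpenPartialHomeomorph M Plane) (hφ : IsChart M φ),
      ∀ (t : ℝ), ∀ x ∈ φ.target, ∀ (v a : Plane) (i : Fin 2),
        ε.coeff hφ i (x, v, a) = eulerLagrange1 (chartFun1 φ L) i (t, x, v, a)

/-- The second-order Lagrangian `L dt`, where `L` is a function on `ℝ × T²M`, is smooth, and its
Euler–Lagrange form is `ε`. -/
def SourceForm.IsSecondOrderLagrangian (ε : SourceForm M) (L : ℝ × T2 M → ℝ) : Prop :=
  ∀ (φ : OpenPartialHomeomorph M Plane) (hφ : IsChart M φ),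
    ContDiffOn ℝ ∞ (chartFun2 hφ L) (univ ×ˢ φ.target ×ˢ univ) ∧
    ∀ (t : ℝ), ∀ x ∈ φ.target, ∀ (v a b c : Plane) (i : Fin 2),
      ε.coeff hφ i (x, v, a) = eulerLagrange2 (chartFun2 hφ L) i (t, x, v, a, b, c)

variable (M) in
/-- A (not necessarily smooth) differential 1-form on the manifold `ℝ × T¹M`. -/
abbrev OneForm : Type _ :=
  ∀ p : ℝ × T1 M, TangentSpace (𝓘(ℝ, ℝ).prod (𝓡 2).tangent) p →L[ℝ] ℝ

/-- The chart expression of a 1-form on `ℝ × T¹M`, a 1-form in the variables `(t, x, ẋ)`: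
the pull-back by the inverse of the chart. -/
def OneForm.inChart (ρ : OneForm M) (φ : OpenPartialHomeomorph M Plane)
    (z : ℝ × Plane × Plane) : (ℝ × Plane × Plane) →L[ℝ] ℝ :=
  (ρ (chartJ1 φ z)).comp
    (mfderiv 𝓘(ℝ, ℝ × Plane × Plane) (𝓘(ℝ, ℝ).prod (𝓡 2).tangent) (chartJ1 φ) z)

/-- Smoothness of a 1-form: all its chart expressions are smooth. -/
def OneForm.IsSmooth (ρ : OneForm M) : Prop :=
  ∀ φ : OpenPartialHomeomorph M Plane, IsChart M φ →
    ContDiffOn ℝ ∞ (OneForm.inChart ρ φ) (univ ×ˢ φ.target ×ˢ univ)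

/-- The horizontalization `hρ = L dt` of a 1-form `ρ` on `ℝ × T¹M`, given by the function `L` on
`ℝ × T²M`: the value of `ρ` on the velocity `(1, w)` of the curve `s ↦ (s, ζ'(s))`, for the
second-order velocity `w` of a curve `ζ`.  In a chart, `h dt = dt`, `h dxⁱ = ẋⁱ dt`,
`h dẋⁱ = ẍⁱ dt`. -/
def OneForm.horizontalization (ρ : OneForm M) (p : ℝ × T2 M) : ℝ :=
  ρ (p.1, p.2.1.proj) ((1, p.2.1.snd) : ℝ × TangentSpace (𝓡 2).tangent p.2.1.proj)

/-- In every chart,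
`μ₀ = - (A_0 - ½ (∂A_0/∂ẋ¹ - ∂A_1/∂ẋ⁰) ẋ¹) t dx⁰ - (A_1 - ½ (∂A_1/∂ẋ⁰ - ∂A_0/∂ẋ¹) ẋ⁰) t dx¹
  - (B_{00} ẋ⁰ + B_{01} ẋ¹) t dẋ⁰ - (B_{01} ẋ⁰ + B_{11} ẋ¹) t dẋ¹`. -/
def SourceForm.IsMuZero (ε : SourceForm M) (μ₀ : OneForm M) : Prop :=
  ∀ (φ : OpenPartialHomeomorph M Plane) (hφ : IsChart M φ),
    ∀ (t : ℝ), ∀ x ∈ φ.target, ∀ (v : Plane) (τ : ℝ) (ξ η : Plane),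
      OneForm.inChart μ₀ φ (t, x, v) (τ, ξ, η) =
        - (ε.A hφ 0 (x, v) - 1 / 2 * (ε.dA hφ 0 1 (x, v) - ε.dA hφ 1 0 (x, v)) * v 1) * t * ξ 0
        - (ε.A hφ 1 (x, v) - 1 / 2 * (ε.dA hφ 1 0 (x, v) - ε.dA hφ 0 1 (x, v)) * v 0) * t * ξ 1
        - (ε.B hφ 0 0 (x, v) * v 0 + ε.B hφ 0 1 (x, v) * v 1) * t * η 0
        - (ε.B hφ 0 1 (x, v) * v 0 + ε.B hφ 1 1 (x, v) * v 1) * t * η 1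

/-- In every chart,
`κ = - (∫₀^{ẋ⁰} B_{00}(x, ν, ẋ¹) dν + ∫₀^{ẋ¹} B_{01}(x, 0, σ) dσ) dx⁰
  - (∫₀^{ẋ⁰} B_{01}(x, ν, ẋ¹) dν + ∫₀^{ẋ¹} B_{11}(x, 0, σ) dσ) dx¹`. -/
def SourceForm.IsKappa (ε : SourceForm M) (κ : OneForm M) : Prop :=
  ∀ (φ : OpenPartialHomeomorph M Plane) (hφ : IsChart M φ),
    ∀ (t : ℝ), ∀ x ∈ φ.target, ∀ (v : Plane) (τ : ℝ) (ξ η : Plane),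
      OneForm.inChart κ φ (t, x, v) (τ, ξ, η) =
        - ((∫ ν in (0 : ℝ)..v 0, ε.B hφ 0 0 (x, !₂[ν, v 1]))
            + ∫ σ in (0 : ℝ)..v 1, ε.B hφ 0 1 (x, !₂[0, σ])) * ξ 0
        - ((∫ ν in (0 : ℝ)..v 0, ε.B hφ 0 1 (x, !₂[ν, v 1]))
            + ∫ σ in (0 : ℝ)..v 1, ε.B hφ 1 1 (x, !₂[0, σ])) * ξ 1

end Forms

end GlobalVar

end

/-! Write `C(x, v, a)` for the covector with components `ε_i`. A local Lagrangian `L` splits by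
Taylor's formula along the fibres into its part affine in `v` at `v = 0` and the remainder `K = ∫₀¹
(1 - s) L_vv(s v)(v, v) ds`. Since `L_vv = -∂C/∂a`, the remainder is determined by `ε` alone
(`kineticPart_eq`): it does not depend on `t` or on the choice of `L`. Under a change of chart the
acceleration transforms affinely with linear part the Jacobian, and `∂C/∂a` does not depend on `a`,
so the expressions of `K` agree on overlaps (`kineticPart_transition`) and `K` is a function on the
whole of `TM`.

The affine part acts like a scalar plus a vector potential. Its Euler–Lagrange expression is `β +
Ω(v, ·)`, where `β = C(x, 0, 0)` is a 1-form on `M` and `Ω` is the curl of `L_v` at rest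
(`elForm_affinePart`). By `fderiv_elForm_velocity_antisymm`, `Ω` is half the skew part of `∂A/∂v` at
rest, so the hypothesis says `Ω = 0`. This holds at all times near a given one, and the skew part of
the derivative of `β` is, up to sign, the time derivative of `Ω`; hence `β` is closed
(`fderiv_restForm_symm`).

A closed `β` has the Lagrangian `-t β(v)`, because the Euler–Lagrange expression of `t β(v)` is `-β`
plus `t` times a contraction of `dβ` (`elForm_time_mul`). No primitive of `β` is needed, which is
why cohomology plays no role. So `K - t β(v)` is a global Lagrangian (`elForm_canonicalLagrangian`,
`globallyVariational`).

For the second claim let `E = K_v v - K` be the energy. Then `κ = K_v dx` and `μ₀ = t (dE - β)` are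
global forms, and `h(μ₀ + κ) = (K - t β(v) + d(t E)/dt) dt` differs from the first Lagrangian by a
total derivative, which has zero Euler–Lagrange expressions (`eulerLagrange2_add_totalDeriv`). The
chart formulas express the derivatives of `K` through `A` and `B` (`B_eq`, `isMuZero`, `isKappa`).
-/

noncomputable section

namespace GlobalVar

/-! ### Derivatives and covariance of the Euler–Lagrange expression -/

section Calculus

variable {E : Type*} [NormedAddCommGroup E] [NormedSpace ℝ E]

/-- The Euler–Lagrange expression of `L(t, x, v)` contracted with the vector `u`. -/
def elForm (L : ℝ × E × E → ℝ) (t : ℝ) (x v a u : E) : ℝ :=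
  fderiv ℝ L (t, x, v) (0, u, 0)
    - fderiv ℝ (fun y => fderiv ℝ L y (0, 0, u)) (t, x, v) (1, v, a)

theorem elForm_congr {L L' : ℝ × E × E → ℝ} {t : ℝ} {x v : E}
    (h : L =ᶠ[𝓝 (t, x, v)] L') (a u : E) : elForm L t x v a u = elForm L' t x v a u := by
  have h2 : (fun y => fderiv ℝ L y (0, 0, u)) =ᶠ[𝓝 (t, x, v)] fun y => fderiv ℝ L' y (0, 0, u) := by
    filter_upwards [h.fderiv (𝕜 := ℝ)] with y hy
    rw [hy]
  rw [elForm, elForm, h.fderiv_eq, h2.fderiv_eq]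

variable {F : Type*} [NormedAddCommGroup F] [NormedSpace ℝ F]
  {G : Type*} [NormedAddCommGroup G] [NormedSpace ℝ G]

theorem _root_.ContDiffAt.fderiv_infty {f : F → G} {z : F} (hf : ContDiffAt ℝ ∞ f z) :
    ContDiffAt ℝ ∞ (fderiv ℝ f) z :=
  hf.fderiv_right (by simp)

theorem _root_.ContDiffAt.differentiableAt_infty {f : F → G} {z : F} (hf : ContDiffAt ℝ ∞ f z) :
    DifferentiableAt ℝ f z :=
  hf.differentiableAt (by simp)

theorem _root_.ContDiffAt.eventually_infty {f : F → G} {z : F} (hf : ContDiffAt ℝ ∞ f z)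
    (n : ℕ) : ∀ᶠ y in 𝓝 z, ContDiffAt ℝ n f y :=
  (hf.of_le (by exact_mod_cast le_top)).eventually (by simp)

theorem fderiv_fderiv_apply {f : F → G} {z : F} (hf : ContDiffAt ℝ ∞ f z) (w d : F) :
    fderiv ℝ (fun y => fderiv ℝ f y w) z d = fderiv ℝ (fderiv ℝ f) z d w := by
  rw [fderiv_clm_apply hf.fderiv_infty.differentiableAt_infty
    (differentiableAt_const w)]
  simp

theorem fderiv_fderiv_symm {f : F → G} {z : F} (hf : ContDiffAt ℝ ∞ f z) (d w : F) :
    fderiv ℝ (fderiv ℝ f) z d w = fderiv ℝ (fderiv ℝ f) z w d :=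
  ((hf.eventually_infty 2).self_of_nhds.isSymmSndFDerivAt
    (by simp [minSmoothness_of_isRCLikeNormedField])).eq d w

theorem elForm_eq {L : ℝ × E × E → ℝ} {t : ℝ} {x v : E} (hL : ContDiffAt ℝ ∞ L (t, x, v))
    (a u : E) : elForm L t x v a u = fderiv ℝ L (t, x, v) (0, u, 0)
      - fderiv ℝ (fderiv ℝ L) (t, x, v) (1, v, a) (0, 0, u) := by
  rw [elForm, fderiv_fderiv_apply hL]

theorem fderiv_third_symm_left {f : F → G} {z : F} (hf : ContDiffAt ℝ ∞ f z) (a b c : F) :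
    fderiv ℝ (fderiv ℝ (fderiv ℝ f)) z a b c = fderiv ℝ (fderiv ℝ (fderiv ℝ f)) z b a c := by
  rw [fderiv_fderiv_symm hf.fderiv_infty]

theorem fderiv_fderiv_fderiv_apply {f : F → G} {z : F} (hf : ContDiffAt ℝ ∞ f z) (b c d : F) :
    fderiv ℝ (fun y => fderiv ℝ (fderiv ℝ f) y b c) z d
      = fderiv ℝ (fderiv ℝ (fderiv ℝ f)) z d b c := by
  have h1 := hf.fderiv_infty.fderiv_infty
  have h2 := h1.differentiableAt_infty
  rw [fderiv_clm_apply (h2.clm_apply (differentiableAt_const b)) (differentiableAt_const c),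
    fderiv_clm_apply h2 (differentiableAt_const b)]
  simp

theorem fderiv_third_symm_right {f : F → G} {z : F} (hf : ContDiffAt ℝ ∞ f z) (a b c : F) :
    fderiv ℝ (fderiv ℝ (fderiv ℝ f)) z a b c = fderiv ℝ (fderiv ℝ (fderiv ℝ f)) z a c b := by
  rw [← fderiv_fderiv_fderiv_apply hf, ← fderiv_fderiv_fderiv_apply hf]
  have : (fun y => fderiv ℝ (fderiv ℝ f) y b c) =ᶠ[𝓝 z] fun y => fderiv ℝ (fderiv ℝ f) y c b := by
    filter_upwards [hf.eventually_infty 2] with y hy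
    exact (hy.isSymmSndFDerivAt (by simp [minSmoothness_of_isRCLikeNormedField])).eq b c
  rw [this.fderiv_eq]

/-- The derivative of the acceleration-free part `A` of an Euler–Lagrange expression in the velocity. -/
theorem fderiv_elForm_velocity {L : ℝ × E × E → ℝ} {t : ℝ} {x v : E}
    (hL : ContDiffAt ℝ ∞ L (t, x, v)) (u w : E) :
    fderiv ℝ (fun v => elForm L t x v 0 u) v w
      = fderiv ℝ (fderiv ℝ L) (t, x, v) (0, 0, w) (0, u, 0)
        - fderiv ℝ (fderiv ℝ L) (t, x, v) (0, w, 0) (0, 0, u)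
        - fderiv ℝ (fderiv ℝ (fderiv ℝ L)) (t, x, v) (0, 0, w) (1, v, 0) (0, 0, u) := by
  have hι : HasFDerivAt (fun v : E => (t, x, v))
      ((0 : E →L[ℝ] ℝ).prod ((0 : E →L[ℝ] E).prod (ContinuousLinearMap.id ℝ E))) v :=
    (hasFDerivAt_const t v).prodMk ((hasFDerivAt_const x v).prodMk (hasFDerivAt_id v))
  have hd : HasFDerivAt (fun v : E => ((1 : ℝ), v, (0 : E)))
      ((0 : E →L[ℝ] ℝ).prod ((ContinuousLinearMap.id ℝ E).prod (0 : E →L[ℝ] E))) v :=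
    (hasFDerivAt_const _ v).prodMk ((hasFDerivAt_id v).prodMk (hasFDerivAt_const _ v))
  have hL1 := hL.fderiv_infty
  have hL2 := hL1.fderiv_infty
  have e1 : (fun v => elForm L t x v 0 u) =ᶠ[𝓝 v] fun v =>
      fderiv ℝ L (t, x, v) (0, u, 0) - fderiv ℝ (fderiv ℝ L) (t, x, v) (1, v, 0) (0, 0, u) := by
    have hc : Filter.Tendsto (fun v : E => (t, x, v)) (𝓝 v) (𝓝 (t, x, v)) := hι.continuousAt
    filter_upwards [hc.eventually (hL.eventually_infty 2)] with y hy
    have : DifferentiableAt ℝ (fderiv ℝ L) (t, x, y) :=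
      (hy.fderiv_right (m := 1) (by norm_num)).differentiableAt (by simp)
    rw [elForm, fderiv_clm_apply this (differentiableAt_const _)]
    simp
  have h1 := ((hL1.differentiableAt_infty.hasFDerivAt.comp v hι).clm_apply
    (hasFDerivAt_const ((0 : ℝ), u, (0 : E)) v))
  have h2 := ((hL2.differentiableAt_infty.hasFDerivAt.comp v hι).clm_apply hd).clm_apply
    (hasFDerivAt_const ((0 : ℝ), (0 : E), u) v)
  have h3 := h1.sub h2
  rw [e1.fderiv_eq]
  refine (congrArg (fun l => l w) h3.fderiv).trans ?_
  simp
  ring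

/-- The third-derivative term of `fderiv_elForm_velocity` is symmetric in `u` and `w` and cancels,
while the two mixed terms coincide and add up. This makes the hypothesis at rest a statement about
the curl of `L_v`. -/
theorem fderiv_elForm_velocity_antisymm {L : ℝ × E × E → ℝ} {t : ℝ} {x v : E}
    (hL : ContDiffAt ℝ ∞ L (t, x, v)) (u w : E) :
    fderiv ℝ (fun v => elForm L t x v 0 u) v w - fderiv ℝ (fun v => elForm L t x v 0 w) v u
      = 2 * (fderiv ℝ (fderiv ℝ L) (t, x, v) (0, u, 0) (0, 0, w)
        - fderiv ℝ (fderiv ℝ L) (t, x, v) (0, w, 0) (0, 0, u)) := by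
  rw [fderiv_elForm_velocity hL, fderiv_elForm_velocity hL,
    fderiv_fderiv_symm hL (0, 0, w) (0, u, 0), fderiv_fderiv_symm hL (0, 0, u) (0, w, 0),
    fderiv_third_symm_left hL (0, 0, w), fderiv_third_symm_left hL (0, 0, u),
    fderiv_third_symm_right hL _ (0, 0, w)]
  ring

/-- The expression is affine in `a`, hence a derivative in which `a` does not occur. -/
theorem hasFDerivAt_elForm_acceleration {L : ℝ × E × E → ℝ} {t : ℝ} {x v : E}
    (hL : ContDiffAt ℝ ∞ L (t, x, v)) (a u : E) :
    HasFDerivAt (fun a => elForm L t x v a u)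
      (-((fderiv ℝ (fderiv ℝ L) (t, x, v)).flip (0, 0, u)).comp
        ((ContinuousLinearMap.inr ℝ ℝ (E × E)).comp (ContinuousLinearMap.inr ℝ E E))) a := by
  have e1 : (fun a => elForm L t x v a u) = fun a => fderiv ℝ L (t, x, v) (0, u, 0)
      - fderiv ℝ (fderiv ℝ L) (t, x, v) (1, v, a) (0, 0, u) := by
    funext a; rw [elForm_eq hL]
  have hd : HasFDerivAt (fun a : E => ((1 : ℝ), v, a))
      ((0 : E →L[ℝ] ℝ).prod ((0 : E →L[ℝ] E).prod (ContinuousLinearMap.id ℝ E))) a :=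
    (hasFDerivAt_const _ a).prodMk ((hasFDerivAt_const _ a).prodMk (hasFDerivAt_id a))
  have h2 := (((hasFDerivAt_const (fderiv ℝ (fderiv ℝ L) (t, x, v)) a).clm_apply hd).clm_apply
    (hasFDerivAt_const ((0 : ℝ), (0 : E), u) a)).const_sub (fderiv ℝ L (t, x, v) (0, u, 0))
  rw [e1]
  refine h2.congr_fderiv ?_
  ext w
  simp

theorem fderiv_elForm_acceleration {L : ℝ × E × E → ℝ} {t : ℝ} {x v : E}
    (hL : ContDiffAt ℝ ∞ L (t, x, v)) (a u w : E) :
    fderiv ℝ (fun a => elForm L t x v a u) a w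
      = - fderiv ℝ (fderiv ℝ L) (t, x, v) (0, 0, w) (0, 0, u) := by
  rw [(hasFDerivAt_elForm_acceleration hL a u).fderiv]
  simp

/-- The Euler–Lagrange expression is a covector under changes of coordinates. -/
theorem elForm_comp {L : ℝ × E × E → ℝ} {T : E → E} {t : ℝ} {x v : E}
    (hT : ContDiffAt ℝ ∞ T x) (hL : ContDiffAt ℝ ∞ L (t, T x, fderiv ℝ T x v)) (a u : E) :
    elForm (fun z => L (z.1, T z.2.1, fderiv ℝ T z.2.1 z.2.2)) t x v a u
      = elForm L t (T x) (fderiv ℝ T x v) (fderiv ℝ T x a + fderiv ℝ (fderiv ℝ T) x v v)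
          (fderiv ℝ T x u) := by
  set Φ : ℝ × E × E → ℝ × E × E := fun z => (z.1, T z.2.1, fderiv ℝ T z.2.1 z.2.2) with hΦ
  have hT1 := hT.fderiv_infty
  have hΦd : ∀ z : ℝ × E × E, DifferentiableAt ℝ T z.2.1 → DifferentiableAt ℝ (fderiv ℝ T) z.2.1 →
      ∀ d : ℝ × E × E, DifferentiableAt ℝ Φ z ∧ fderiv ℝ Φ z d
        = (d.1, fderiv ℝ T z.2.1 d.2.1,
            fderiv ℝ T z.2.1 d.2.2 + fderiv ℝ (fderiv ℝ T) z.2.1 d.2.1 z.2.2) := by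
    intro z h1 h2 d
    have hx : HasFDerivAt (fun z : ℝ × E × E => z.2.1) _ z :=
      (hasFDerivAt_snd (𝕜 := ℝ) (p := z)).fst
    have hv : HasFDerivAt (fun z : ℝ × E × E => z.2.2) _ z :=
      (hasFDerivAt_snd (𝕜 := ℝ) (p := z)).snd
    have k : HasFDerivAt Φ _ z := (hasFDerivAt_fst (𝕜 := ℝ) (p := z)).prodMk
      ((h1.hasFDerivAt.comp z hx).prodMk ((h2.hasFDerivAt.comp z hx).clm_apply hv))
    refine ⟨k.differentiableAt, ?_⟩
    rw [k.fderiv]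
    simp
  have hΦc : ContDiffAt ℝ ∞ Φ (t, x, v) := by
    have hx : ContDiffAt ℝ ∞ (fun z : ℝ × E × E => z.2.1) (t, x, v) := by fun_prop
    have hv : ContDiffAt ℝ ∞ (fun z : ℝ × E × E => z.2.2) (t, x, v) := by fun_prop
    refine ContDiffAt.prodMk contDiffAt_fst (ContDiffAt.prodMk ?_ (ContDiffAt.clm_apply ?_ hv))
    · exact ContDiffAt.comp (t, x, v) (f := fun z : ℝ × E × E => z.2.1) hT hx
    · exact ContDiffAt.comp (t, x, v) (f := fun z : ℝ × E × E => z.2.1) hT1 hx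
  have hev : ∀ᶠ z in 𝓝 ((t, x, v) : ℝ × E × E), DifferentiableAt ℝ T z.2.1 ∧
      DifferentiableAt ℝ (fderiv ℝ T) z.2.1 ∧ DifferentiableAt ℝ L (Φ z) := by
    have hx : Filter.Tendsto (fun z : ℝ × E × E => z.2.1) (𝓝 (t, x, v)) (𝓝 x) :=
      (continuous_fst.comp continuous_snd).continuousAt
    filter_upwards [hx.eventually (hT.eventually_infty 2),
      hΦc.continuousAt.eventually (hL.eventually_infty 1)] with z h1 h2
    exact ⟨h1.differentiableAt (by simp),
      (h1.fderiv_right (m := 1) (by norm_num)).differentiableAt (by simp),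
      h2.differentiableAt (by simp)⟩
  have hD : ∀ d : ℝ × E × E, (fun z => fderiv ℝ (L ∘ Φ) z d) =ᶠ[𝓝 (t, x, v)] fun z =>
      fderiv ℝ L (Φ z) (d.1, fderiv ℝ T z.2.1 d.2.1,
        fderiv ℝ T z.2.1 d.2.2 + fderiv ℝ (fderiv ℝ T) z.2.1 d.2.1 z.2.2) := by
    intro d
    filter_upwards [hev] with z ⟨h1, h2, h3⟩
    rw [fderiv_comp z h3 (hΦd z h1 h2 d).1, ContinuousLinearMap.comp_apply, (hΦd z h1 h2 d).2]
  have hL1 := hL.fderiv_infty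
  change elForm (L ∘ Φ) t x v a u = _
  rw [elForm_eq hL, elForm, (hD (0, u, 0)).eq_of_nhds, (hD (0, 0, u)).fderiv_eq]
  have hx : HasFDerivAt (fun z : ℝ × E × E => z.2.1) _ (t, x, v) :=
    (hasFDerivAt_snd (𝕜 := ℝ) (p := (t, x, v))).fst
  have hTu := (hT1.differentiableAt_infty.hasFDerivAt.comp ((t, x, v) : ℝ × E × E)
    hx).clm_apply (hasFDerivAt_const u _)
  have hc : HasFDerivAt (fun z : ℝ × E × E => ((0 : ℝ), (0 : E), fderiv ℝ T z.2.1 u)) _ (t, x, v) :=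
    (hasFDerivAt_const (0 : ℝ) _).prodMk ((hasFDerivAt_const (0 : E) _).prodMk hTu)
  have hLΦ := (hL1.differentiableAt_infty.hasFDerivAt.comp ((t, x, v) : ℝ × E × E)
    (hΦd (t, x, v) hT.differentiableAt_infty hT1.differentiableAt_infty
      (1, v, a)).1.hasFDerivAt)
  have hk := hLΦ.clm_apply hc
  have e2 : (fun z : ℝ × E × E => fderiv ℝ L (Φ z) (0, fderiv ℝ T z.2.1 0,
        fderiv ℝ T z.2.1 u + fderiv ℝ (fderiv ℝ T) z.2.1 0 z.2.2))
      = fun z => fderiv ℝ L (Φ z) (0, 0, fderiv ℝ T z.2.1 u) := by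
    funext z; simp
  have e3 := (hΦd (t, x, v) hT.differentiableAt_infty hT1.differentiableAt_infty (1, v, a)).2
  simp only [] at e3 ⊢
  rw [e2]
  have e4 := congrArg (fun l => l (1, v, a)) hk.fderiv
  refine (congrArg₂ (· - ·) rfl e4).trans ?_
  simp [e3]
  -- The second derivative of `T` enters once through `∂/∂x` and once through `d/dt`; by symmetry
  -- the two contributions, both paired with `L_v`, cancel.
  rw [fderiv_fderiv_symm hT u v]
  have : ((0 : ℝ), fderiv ℝ T x u, fderiv ℝ (fderiv ℝ T) x v u)
    = (0, fderiv ℝ T x u, 0) + (0, 0, fderiv ℝ (fderiv ℝ T) x v u) := by simp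
  simp only [hΦ]
  rw [this, map_add]
  ring

end Calculus

/-! ### Splitting a Lagrangian into its affine part and a Taylor remainder -/

section Calculus

variable {E : Type*} [NormedAddCommGroup E] [NormedSpace ℝ E]

theorem elForm_sub {L L' : ℝ × E × E → ℝ} {t : ℝ} {x v : E} (hL : ContDiffAt ℝ ∞ L (t, x, v))
    (hL' : ContDiffAt ℝ ∞ L' (t, x, v)) (a u : E) :
    elForm (fun z => L z - L' z) t x v a u = elForm L t x v a u - elForm L' t x v a u := by
  have e1 : (fun y => fderiv ℝ (fun z => L z - L' z) y (0, 0, u)) =ᶠ[𝓝 (t, x, v)]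
      fun y => fderiv ℝ L y (0, 0, u) - fderiv ℝ L' y (0, 0, u) := by
    filter_upwards [hL.eventually_infty 1, hL'.eventually_infty 1] with y h1 h2
    rw [fderiv_fun_sub (h1.differentiableAt (by simp)) (h2.differentiableAt (by simp))]
    simp
  have d1 := hL.fderiv_infty.differentiableAt_infty.clm_apply
    (differentiableAt_const ((0 : ℝ), (0 : E), u))
  have d2 := hL'.fderiv_infty.differentiableAt_infty.clm_apply
    (differentiableAt_const ((0 : ℝ), (0 : E), u))
  rw [elForm, elForm, elForm, e1.fderiv_eq,
    fderiv_fun_sub hL.differentiableAt_infty hL'.differentiableAt_infty,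
    fderiv_fun_sub d1 d2]
  simp
  ring

theorem fderiv_comp_snd_apply {K : E × E → ℝ} {z : ℝ × E × E} (hK : DifferentiableAt ℝ K z.2)
    (d : ℝ × E × E) : fderiv ℝ (fun z : ℝ × E × E => K z.2) z d = fderiv ℝ K z.2 d.2 := by
  have := hK.hasFDerivAt.comp z (hasFDerivAt_snd (𝕜 := ℝ) (p := z))
  exact congrArg (fun l => l d) this.fderiv

theorem fderiv_fderiv_comp_snd_apply {K : E × E → ℝ} {z : ℝ × E × E}
    (hK : ContDiffAt ℝ ∞ K z.2) (d d' : ℝ × E × E) :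
    fderiv ℝ (fderiv ℝ (fun z : ℝ × E × E => K z.2)) z d d'
      = fderiv ℝ (fderiv ℝ K) z.2 d.2 d'.2 := by
  have hs : ContDiffAt ℝ ∞ (fun z : ℝ × E × E => z.2) z := contDiffAt_snd
  have hKs : ContDiffAt ℝ ∞ (fun z : ℝ × E × E => K z.2) z := hK.comp z hs
  have e1 : (fun y => fderiv ℝ (fun z : ℝ × E × E => K z.2) y d') =ᶠ[𝓝 z]
      fun y => fderiv ℝ K y.2 d'.2 := by
    filter_upwards [hs.continuousAt.eventually (hK.eventually_infty 1)] with y hy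
    exact fderiv_comp_snd_apply (hy.differentiableAt (by simp)) _
  rw [← fderiv_fderiv_apply hKs, e1.fderiv_eq, ← fderiv_fderiv_apply hK]
  exact fderiv_comp_snd_apply (K := fun y => fderiv ℝ K y d'.2)
    (hK.fderiv_infty.differentiableAt_infty.clm_apply (differentiableAt_const d'.2)) d

/-- The Euler–Lagrange expression of an autonomous Lagrange function. -/
theorem elForm_autonomous {K : E × E → ℝ} {x v : E} (hK : ContDiffAt ℝ ∞ K (x, v))
    (t : ℝ) (a u : E) :
    elForm (fun z => K z.2) t x v a u
      = fderiv ℝ K (x, v) (u, 0) - fderiv ℝ (fderiv ℝ K) (x, v) (v, a) (0, u) := by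
  have hKs : ContDiffAt ℝ ∞ (fun z : ℝ × E × E => K z.2) (t, x, v) :=
    hK.comp (f := fun z : ℝ × E × E => z.2) (t, x, v) contDiffAt_snd
  rw [elForm_eq hKs,
    fderiv_fderiv_comp_snd_apply (z := (t, x, v)) hK,
    fderiv_comp_snd_apply (z := (t, x, v)) hK.differentiableAt_infty]

/-- The Euler–Lagrange expression of `t ↦ t β`, for a `1`-form `β` on the configuration space. -/
theorem elForm_time_mul {b : E → E →L[ℝ] ℝ} {x : E} (hb : ContDiffAt ℝ ∞ b x)
    (t : ℝ) (v a u : E) :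
    elForm (fun z => z.1 * b z.2.1 z.2.2) t x v a u
      = - b x u + t * (fderiv ℝ b x u v - fderiv ℝ b x v u) := by
  have hx : ∀ z : ℝ × E × E, HasFDerivAt (fun z : ℝ × E × E => z.2.1) _ z := fun z =>
    (hasFDerivAt_snd (𝕜 := ℝ) (p := z)).fst
  have hv : ∀ z : ℝ × E × E, HasFDerivAt (fun z : ℝ × E × E => z.2.2) _ z := fun z =>
    (hasFDerivAt_snd (𝕜 := ℝ) (p := z)).snd
  have hd : ∀ z : ℝ × E × E, DifferentiableAt ℝ b z.2.1 → ∀ d : ℝ × E × E,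
      fderiv ℝ (fun z : ℝ × E × E => z.1 * b z.2.1 z.2.2) z d
        = z.1 * (b z.2.1 d.2.2 + fderiv ℝ b z.2.1 d.2.1 z.2.2) + d.1 * b z.2.1 z.2.2 := by
    intro z h d
    have := (hasFDerivAt_fst (𝕜 := ℝ) (p := z)).mul
      ((h.hasFDerivAt.comp z (hx z)).clm_apply (hv z))
    refine (congrArg (fun l => l d) this.fderiv).trans ?_
    simp
    ring
  have e1 : (fun y => fderiv ℝ (fun z : ℝ × E × E => z.1 * b z.2.1 z.2.2) y (0, 0, u))
      =ᶠ[𝓝 (t, x, v)] fun y => y.1 * b y.2.1 u := by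
    have hc : Filter.Tendsto (fun z : ℝ × E × E => z.2.1) (𝓝 (t, x, v)) (𝓝 x) :=
      (continuous_fst.comp continuous_snd).continuousAt
    filter_upwards [hc.eventually (hb.eventually_infty 1)] with y hy
    rw [hd y (hy.differentiableAt (by simp))]
    simp
  have h2 := (hasFDerivAt_fst (𝕜 := ℝ) (p := ((t, x, v) : ℝ × E × E))).mul
    ((hb.differentiableAt_infty.hasFDerivAt.comp ((t, x, v) : ℝ × E × E) (hx _)).clm_apply
      (hasFDerivAt_const u _))
  rw [elForm, e1.fderiv_eq, hd _ hb.differentiableAt_infty]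
  have e2 := congrArg (fun l => l ((1 : ℝ), v, a)) h2.fderiv
  refine (congrArg₂ (· - ·) rfl e2).trans ?_
  simp
  ring

/-- Second order Taylor formula with integral remainder along the fibres. -/
theorem integral_fderiv_fderiv_fibre {L : ℝ × E × E → ℝ} {t : ℝ} {x : E}
    (hL : ∀ v, ContDiffAt ℝ ∞ L (t, x, v)) (v : E) :
    ∫ s in (0 : ℝ)..1, (s - 1) * -fderiv ℝ (fderiv ℝ L) (t, x, s • v) (0, 0, v) (0, 0, v)
      = L (t, x, v) - L (t, x, 0) - fderiv ℝ L (t, x, 0) (0, 0, v) := by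
  have hγ : ∀ s : ℝ, HasDerivAt (fun s : ℝ => (t, x, s • v)) ((0 : ℝ), (0 : E), v) s := by
    intro s
    have := (hasDerivAt_const s t).prodMk ((hasDerivAt_const s x).prodMk
      ((hasDerivAt_id s).smul_const v))
    simpa using this
  have h0 : ∀ s : ℝ, HasDerivAt (fun s : ℝ => L (t, x, s • v))
      (fderiv ℝ L (t, x, s • v) (0, 0, v)) s := fun s =>
    (hL (s • v)).differentiableAt_infty.hasFDerivAt.comp_hasDerivAt s (hγ s)
  have h1 : ∀ s : ℝ, HasDerivAt (fun s : ℝ => fderiv ℝ L (t, x, s • v) (0, 0, v))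
      (fderiv ℝ (fderiv ℝ L) (t, x, s • v) (0, 0, v) (0, 0, v)) s := by
    intro s
    have k : HasDerivAt (fun s : ℝ => fderiv ℝ L (t, x, s • v))
        (fderiv ℝ (fderiv ℝ L) (t, x, s • v) (0, 0, v)) s :=
      (hL (s • v)).fderiv_infty.differentiableAt_infty.hasFDerivAt.comp_hasDerivAt s (hγ s)
    exact (k.clm_apply (hasDerivAt_const s ((0 : ℝ), (0 : E), v))).congr_deriv (by simp)
  -- Integration by parts in the form of an explicit primitive of `(1 - s) L_vv(s v)(v, v)`.
  have h2 : ∀ s : ℝ, HasDerivAt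
      (fun s : ℝ => (1 - s) * fderiv ℝ L (t, x, s • v) (0, 0, v) + L (t, x, s • v))
      ((s - 1) * -fderiv ℝ (fderiv ℝ L) (t, x, s • v) (0, 0, v) (0, 0, v)) s := by
    intro s
    exact ((((hasDerivAt_id' s).const_sub 1).mul (h1 s)).add (h0 s)).congr_deriv (by ring)
  rw [intervalIntegral.integral_eq_sub_of_hasDerivAt (fun s _ => h2 s)]
  · simp
    ring
  · refine Continuous.intervalIntegrable ?_ _ _
    refine (continuous_id.sub continuous_const).mul (Continuous.neg ?_)
    refine continuous_iff_continuousAt.2 fun s => ?_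
    have := ((hL (s • v)).fderiv_infty.fderiv_infty.continuousAt.comp (f := fun s : ℝ =>
      (t, x, s • v)) (hγ s).continuousAt)
    exact (this.clm_apply continuousAt_const).clm_apply continuousAt_const

/-- The part of a Lagrange function of order at most one in the velocity. -/
def affinePart (L : ℝ × E × E → ℝ) (z : ℝ × E × E) : ℝ :=
  L (z.1, z.2.1, 0) + fderiv ℝ L (z.1, z.2.1, 0) (0, 0, z.2.2)

theorem contDiffAt_affinePart {L : ℝ × E × E → ℝ} {t : ℝ} {x : E}
    (hL : ContDiffAt ℝ ∞ L (t, x, 0)) (v : E) : ContDiffAt ℝ ∞ (affinePart L) (t, x, v) := by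
  have hι : ContDiffAt ℝ ∞ (fun z : ℝ × E × E => (z.1, z.2.1, (0 : E))) (t, x, v) := by fun_prop
  have h1 := hL.comp (f := fun z : ℝ × E × E => (z.1, z.2.1, (0 : E))) (t, x, v) hι
  have h2 := hL.fderiv_infty.comp (f := fun z : ℝ × E × E => (z.1, z.2.1, (0 : E))) (t, x, v) hι
  exact h1.add (h2.clm_apply (by fun_prop))

/-- A scalar potential `L(t, x, 0)` and a vector potential `L_v(t, x, 0)` produce an electric term,
which is the expression of `L` at rest, and a magnetic term linear in `v`, the curl of the vector
potential. The acceleration drops out. -/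
theorem elForm_affinePart {L : ℝ × E × E → ℝ} {t : ℝ} {x : E}
    (hL : ContDiffAt ℝ ∞ L (t, x, 0)) (v a u : E) :
    elForm (affinePart L) t x v a u = elForm L t x 0 0 u
      + (fderiv ℝ (fderiv ℝ L) (t, x, 0) (0, u, 0) (0, 0, v)
        - fderiv ℝ (fderiv ℝ L) (t, x, 0) (0, v, 0) (0, 0, u)) := by
  have hι : ∀ z : ℝ × E × E, HasFDerivAt (fun z : ℝ × E × E => (z.1, z.2.1, (0 : E)))
      ((ContinuousLinearMap.fst ℝ ℝ (E × E)).prod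
        (((ContinuousLinearMap.fst ℝ E E).comp (ContinuousLinearMap.snd ℝ ℝ (E × E))).prod 0)) z :=
    fun z => (hasFDerivAt_fst (𝕜 := ℝ) (p := z)).prodMk
      ((hasFDerivAt_snd (𝕜 := ℝ) (p := z)).fst.prodMk (hasFDerivAt_const 0 z))
  have hd0 : ∀ z : ℝ × E × E, HasFDerivAt (fun z : ℝ × E × E => ((0 : ℝ), (0 : E), z.2.2))
      ((0 : (ℝ × E × E) →L[ℝ] ℝ).prod ((0 : (ℝ × E × E) →L[ℝ] E).prod
        ((ContinuousLinearMap.snd ℝ E E).comp (ContinuousLinearMap.snd ℝ ℝ (E × E))))) z :=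
    fun z => (hasFDerivAt_const 0 z).prodMk ((hasFDerivAt_const 0 z).prodMk
      (hasFDerivAt_snd (𝕜 := ℝ) (p := z)).snd)
  have hd : ∀ z : ℝ × E × E, ContDiffAt ℝ 2 L (z.1, z.2.1, 0) → ∀ d : ℝ × E × E,
      fderiv ℝ (affinePart L) z d = fderiv ℝ L (z.1, z.2.1, 0) (d.1, d.2.1, 0)
        + (fderiv ℝ (fderiv ℝ L) (z.1, z.2.1, 0) (d.1, d.2.1, 0) (0, 0, z.2.2)
          + fderiv ℝ L (z.1, z.2.1, 0) (0, 0, d.2.2)) := by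
    intro z h d
    have k0 := (h.differentiableAt (by simp)).hasFDerivAt.comp z (hι z)
    have k1 := ((h.fderiv_right (m := 1) (by norm_num)).differentiableAt
      (by simp)).hasFDerivAt.comp z (hι z)
    refine (congrArg (fun l => l d) (k0.add (k1.clm_apply (hd0 z))).fderiv).trans ?_
    simp
    ring
  have e1 : (fun y => fderiv ℝ (affinePart L) y (0, 0, u))
      =ᶠ[𝓝 (t, x, v)] fun y => fderiv ℝ L (y.1, y.2.1, 0) (0, 0, u) := by
    have hc : Filter.Tendsto (fun z : ℝ × E × E => (z.1, z.2.1, (0 : E))) (𝓝 (t, x, v))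
      (𝓝 (t, x, 0)) := (hι (t, x, v)).continuousAt
    filter_upwards [hc.eventually (hL.eventually_infty 2)] with y hy
    rw [hd y hy]
    have : ((0 : ℝ), (0 : E), (0 : E)) = 0 := rfl
    simp [this]
  have k2 := (hL.fderiv_infty.differentiableAt_infty.hasFDerivAt.comp
    ((t, x, v) : ℝ × E × E) (hι _)).clm_apply (hasFDerivAt_const ((0 : ℝ), (0 : E), u) _)
  rw [elForm_eq hL, elForm, e1.fderiv_eq, hd _ (hL.eventually_infty 2).self_of_nhds]
  have e2 := congrArg (fun l => l ((1 : ℝ), v, a)) k2.fderiv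
  refine (congrArg₂ (· - ·) rfl e2).trans ?_
  have e3 : ((1 : ℝ), v, (0 : E)) = (1, 0, 0) + (0, v, 0) := by simp
  have e4 : ((0 : ℝ), (0 : E), (0 : E)) = 0 := rfl
  simp only [add_apply, ContinuousLinearMap.comp_apply,
    ContinuousLinearMap.prod_apply, ContinuousLinearMap.flip_apply, zero_apply,
    ContinuousLinearMap.coe_fst', ContinuousLinearMap.coe_snd', e3, e4, map_add, map_zero,
    Function.comp_apply]
  ring

/-- The autonomous part `∫₀¹ (s - 1) ∂C/∂a (x, s v) (v, v) ds` of the Lagrange function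
constructed from a variational covector `C(x, v, a)`. -/
def kineticPart (C : E → E → E → E → ℝ) (z : E × E) : ℝ :=
  ∫ s in (0 : ℝ)..1, (s - 1) * fderiv ℝ (fun a => C z.1 (s • z.2) a z.2) 0 z.2

/-- The Lagrange function `K(x, v) - t C(x, 0, 0)(v)` of a variational covector `C(x, v, a)`. -/
def canonicalLagrangian (C : E → E → E → E → ℝ) (z : ℝ × E × E) : ℝ :=
  kineticPart C z.2 - z.1 * C z.2.1 0 0 z.2.2

/-! ### The canonical Lagrangian over a single chart -/

section Local

variable {J : Set ℝ} {U : Set E} {L : ℝ × E × E → ℝ} {C : E → E → E → E → ℝ}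

/-- Since `∂C/∂a = -L_vv`, the integral is the second-order Taylor remainder of `L` along the fibre.
It follows that this remainder is the same at every time in `J`, and that `K` inherits the
smoothness of `L`. -/
theorem kineticPart_eq (hL : ∀ t ∈ J, ∀ x ∈ U, ∀ v, ContDiffAt ℝ ∞ L (t, x, v))
    (hC : ∀ t ∈ J, ∀ x ∈ U, ∀ v a u, C x v a u = elForm L t x v a u)
    {t : ℝ} (ht : t ∈ J) {x : E} (hx : x ∈ U) (v : E) :
    kineticPart C (x, v) = L (t, x, v) - affinePart L (t, x, v) := by
  have : kineticPart C (x, v) = ∫ s in (0 : ℝ)..1,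
      (s - 1) * -fderiv ℝ (fderiv ℝ L) (t, x, s • v) (0, 0, v) (0, 0, v) := by
    refine intervalIntegral.integral_congr fun s _ => ?_
    have e : (fun a => C x (s • v) a v) = fun a => elForm L t x (s • v) a v := by
      funext a; exact hC t ht x hx _ _ _
    simp only [e, fderiv_elForm_acceleration (hL t ht x hx _)]
  rw [this, integral_fderiv_fderiv_fibre (hL t ht x hx), affinePart]
  ring

/-- A Taylor remainder of second order has no linear term. This is what lets the integrals in `κ`
start at zero velocity with no integration constant. -/
theorem fderiv_kineticPart_zero (hL : ∀ t ∈ J, ∀ x ∈ U, ∀ v, ContDiffAt ℝ ∞ L (t, x, v))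
    (hC : ∀ t ∈ J, ∀ x ∈ U, ∀ v a u, C x v a u = elForm L t x v a u)
    {t : ℝ} (ht : t ∈ J) {x : E} (hx : x ∈ U) :
    fderiv ℝ (fun v => kineticPart C (x, v)) 0 = 0 := by
  have hι : HasFDerivAt (fun v : E => (t, x, v)) ((ContinuousLinearMap.inr ℝ ℝ (E × E)).comp
      (ContinuousLinearMap.inr ℝ E E)) 0 :=
    ((hasFDerivAt_const t (0 : E)).prodMk
      ((hasFDerivAt_const x (0 : E)).prodMk (hasFDerivAt_id (0 : E)))).congr_fderiv rfl
  have h1 := (hL t ht x hx 0).differentiableAt_infty.hasFDerivAt.comp (0 : E) hι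
  have h2 := ((fderiv ℝ L (t, x, 0)).comp ((ContinuousLinearMap.inr ℝ ℝ (E × E)).comp
      (ContinuousLinearMap.inr ℝ E E))).hasFDerivAt (x := 0)
  have e : (fun v => kineticPart C (x, v)) = fun v => L (t, x, v) - (L (t, x, 0)
      + ((fderiv ℝ L (t, x, 0)).comp ((ContinuousLinearMap.inr ℝ ℝ (E × E)).comp
      (ContinuousLinearMap.inr ℝ E E))) v) := by
    funext v
    rw [kineticPart_eq hL hC ht hx, affinePart]
    rfl
  rw [e]
  refine (h1.sub (h2.const_add (L (t, x, 0)))).fderiv.trans ?_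
  simp

/-- The `1`-form `C(x, 0, 0)`, computed from a Lagrange function at the time `t`. -/
def restForm (L : ℝ × E × E → ℝ) (t : ℝ) (x : E) : E →L[ℝ] ℝ :=
  (fderiv ℝ L (t, x, 0)).comp
      ((ContinuousLinearMap.inr ℝ ℝ (E × E)).comp (ContinuousLinearMap.inl ℝ E E))
    - (fderiv ℝ (fderiv ℝ L) (t, x, 0) (1, 0, 0)).comp
      ((ContinuousLinearMap.inr ℝ ℝ (E × E)).comp (ContinuousLinearMap.inr ℝ E E))

theorem elForm_rest {t : ℝ} {x : E} (hL : ContDiffAt ℝ ∞ L (t, x, 0)) (u : E) :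
    elForm L t x 0 0 u = restForm L t x u := by
  rw [elForm_eq hL]
  simp [restForm]

theorem contDiffAt_restForm {t : ℝ} {x : E} (hL : ContDiffAt ℝ ∞ L (t, x, 0)) :
    ContDiffAt ℝ ∞ (restForm L t) x := by
  have hι : ContDiffAt ℝ ∞ (fun x : E => (t, x, (0 : E))) x := by fun_prop
  have h1 := hL.fderiv_infty.comp (f := fun x : E => (t, x, (0 : E))) x hι
  have h2 := hL.fderiv_infty.fderiv_infty.comp (f := fun x : E => (t, x, (0 : E))) x hι
  exact (h1.clm_comp contDiffAt_const).sub
    ((h2.clm_apply contDiffAt_const).clm_comp contDiffAt_const)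

theorem fderiv_restForm {t : ℝ} {x : E} (hL : ContDiffAt ℝ ∞ L (t, x, 0)) (w u : E) :
    fderiv ℝ (restForm L t) x w u = fderiv ℝ (fderiv ℝ L) (t, x, 0) (0, w, 0) (0, u, 0)
      - fderiv ℝ (fderiv ℝ (fderiv ℝ L)) (t, x, 0) (0, w, 0) (1, 0, 0) (0, 0, u) := by
  have hι : HasFDerivAt (fun x : E => (t, x, (0 : E)))
      ((0 : E →L[ℝ] ℝ).prod ((ContinuousLinearMap.id ℝ E).prod 0)) x :=
    (hasFDerivAt_const t x).prodMk ((hasFDerivAt_id x).prodMk (hasFDerivAt_const 0 x))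
  have h1 := hL.fderiv_infty.differentiableAt_infty.hasFDerivAt.comp x hι
  have h2 := hL.fderiv_infty.fderiv_infty.differentiableAt_infty.hasFDerivAt.comp x hι
  have h3 := (h1.clm_comp (hasFDerivAt_const
      ((ContinuousLinearMap.inr ℝ ℝ (E × E)).comp (ContinuousLinearMap.inl ℝ E E)) x)).sub
    ((h2.clm_apply (hasFDerivAt_const ((1 : ℝ), (0 : E), (0 : E)) x)).clm_comp (hasFDerivAt_const
      ((ContinuousLinearMap.inr ℝ ℝ (E × E)).comp (ContinuousLinearMap.inr ℝ E E)) x))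
  refine (congrArg (fun l => l w u) h3.fderiv).trans ?_
  simp

/-- If the mixed derivatives of `L` at rest are symmetric at all times, the form `C(x, 0, 0)` is
closed. -/
theorem fderiv_restForm_symm {t : ℝ} {x : E} (hL : ContDiffAt ℝ ∞ L (t, x, 0))
    (hs : ∀ᶠ τ in 𝓝 t, ∀ u w : E, fderiv ℝ (fderiv ℝ L) (τ, x, 0) (0, u, 0) (0, 0, w)
      = fderiv ℝ (fderiv ℝ L) (τ, x, 0) (0, w, 0) (0, 0, u)) (w u : E) :
    fderiv ℝ (restForm L t) x w u = fderiv ℝ (restForm L t) x u w := by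
  have hι : HasDerivAt (fun t : ℝ => (t, x, (0 : E))) ((1 : ℝ), (0 : E), (0 : E)) t :=
    (hasDerivAt_id t).prodMk ((hasDerivAt_const t x).prodMk (hasDerivAt_const t 0))
  have h2 : ∀ w u : E, HasDerivAt
      (fun τ => fderiv ℝ (fderiv ℝ L) (τ, x, 0) (0, w, 0) (0, 0, u))
      (fderiv ℝ (fderiv ℝ (fderiv ℝ L)) (t, x, 0) (1, 0, 0) (0, w, 0) (0, 0, u)) t := by
    intro w u
    have k : HasDerivAt (fun τ : ℝ => fderiv ℝ (fderiv ℝ L) (τ, x, 0))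
        (fderiv ℝ (fderiv ℝ (fderiv ℝ L)) (t, x, 0) (1, 0, 0)) t :=
      HasFDerivAt.comp_hasDerivAt t (l := fderiv ℝ (fderiv ℝ L))
        hL.fderiv_infty.fderiv_infty.differentiableAt_infty.hasFDerivAt hι
    exact ((k.clm_apply (hasDerivAt_const t ((0 : ℝ), w, (0 : E)))).clm_apply
      (hasDerivAt_const t ((0 : ℝ), (0 : E), u))).congr_deriv (by simp)
  -- Differentiating the symmetry in time gives the symmetry of the third-derivative term, the only
  -- possibly skew term in the derivative of the rest form.
  have h3 := (h2 w u).unique ((h2 u w).congr_of_eventuallyEq (hs.mono fun τ h => h w u))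
  rw [fderiv_restForm hL, fderiv_restForm hL, fderiv_third_symm_left hL (0, w, 0),
    fderiv_third_symm_left hL (0, u, 0), h3, fderiv_fderiv_symm hL]

/-- The canonical Lagrange function of a locally variational covector whose Lorentz-type curvature
vanishes at rest is a smooth Lagrange function for it at all times. -/
theorem elForm_canonicalLagrangian (hJ : IsOpen J) (hU : IsOpen U)
    (hL : ∀ t ∈ J, ∀ x ∈ U, ∀ v, ContDiffAt ℝ ∞ L (t, x, v))
    (hC : ∀ t ∈ J, ∀ x ∈ U, ∀ v a u, C x v a u = elForm L t x v a u)
    (hω : ∀ x ∈ U, ∀ u w,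
      fderiv ℝ (fun v => C x v 0 u) 0 w = fderiv ℝ (fun v => C x v 0 w) 0 u)
    {t₀ : ℝ} (ht₀ : t₀ ∈ J) {x : E} (hx : x ∈ U) (t : ℝ) (v : E) :
    ContDiffAt ℝ ∞ (kineticPart C) (x, v) ∧
    ContDiffAt ℝ ∞ (fun z : E × E => C z.1 0 0 z.2) (x, v) ∧
    ∀ a u, C x v a u = elForm (canonicalLagrangian C) t x v a u := by
  have hUv : ∀ v, ∀ᶠ y in 𝓝 ((x, v) : E × E), y.1 ∈ U := fun v =>
    (hU.preimage continuous_fst).mem_nhds hx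
  have hrest : ∀ t ∈ J, ∀ x ∈ U, ∀ u, C x 0 0 u = restForm L t x u := fun t ht x hx u => by
    rw [hC t ht x hx, elForm_rest (hL t ht x hx 0)]
  -- The condition on `C` involves no time, so the curl of `L_v` at rest vanishes throughout the
  -- open set `J`, which permits differentiating it in time.
  have hsymm : ∀ t ∈ J, ∀ u w : E, fderiv ℝ (fderiv ℝ L) (t, x, 0) (0, u, 0) (0, 0, w)
      = fderiv ℝ (fderiv ℝ L) (t, x, 0) (0, w, 0) (0, 0, u) := by
    intro t ht u w
    have h1 : ∀ u, (fun v => C x v 0 u) = fun v => elForm L t x v 0 u := fun u => by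
      funext v; exact hC t ht x hx _ _ _
    have h2 := hω x hx u w
    rw [h1, h1] at h2
    linarith [fderiv_elForm_velocity_antisymm (hL t ht x hx 0) u w]
  have hclosed := fderiv_restForm_symm (hL t₀ ht₀ x hx 0)
    (Filter.eventually_of_mem (hJ.mem_nhds ht₀) hsymm)
  have hb := contDiffAt_restForm (hL t₀ ht₀ x hx 0)
  have hsnd : ContDiffAt ℝ ∞ (fun z : E × E => (t₀, z)) (x, v) := by fun_prop
  have hK : ContDiffAt ℝ ∞ (kineticPart C) (x, v) := by
    have k := ((hL t₀ ht₀ x hx v).sub (contDiffAt_affinePart (hL t₀ ht₀ x hx 0) v)).comp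
      (f := fun z : E × E => (t₀, z)) (x, v) hsnd
    refine k.congr_of_eventuallyEq ?_
    filter_upwards [hUv v] with y hy
    exact kineticPart_eq hL hC ht₀ hy y.2
  have hβ : ContDiffAt ℝ ∞ (fun z : E × E => C z.1 0 0 z.2) (x, v) := by
    have k : ContDiffAt ℝ ∞ (fun z : E × E => restForm L t₀ z.1 z.2) (x, v) :=
      (hb.comp (f := fun z : E × E => z.1) (x, v) contDiffAt_fst).clm_apply contDiffAt_snd
    refine k.congr_of_eventuallyEq ?_
    filter_upwards [hUv v] with y hy
    exact hrest t₀ ht₀ y.1 hy y.2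
  refine ⟨hK, hβ, fun a u => ?_⟩
  have hK' : ∀ t, ContDiffAt ℝ ∞ (fun z : ℝ × E × E => kineticPart C z.2) (t, x, v) := fun t =>
    hK.comp (f := fun z : ℝ × E × E => z.2) (t, x, v) contDiffAt_snd
  have hb' : ContDiffAt ℝ ∞ (fun z : ℝ × E × E => z.1 * restForm L t₀ z.2.1 z.2.2) (t, x, v) :=
    contDiffAt_fst.mul ((hb.comp (f := fun z : ℝ × E × E => z.2.1) (t, x, v)
      (by fun_prop)).clm_apply (by fun_prop))
  have e1 : canonicalLagrangian C =ᶠ[𝓝 (t, x, v)]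
      fun z => kineticPart C z.2 - z.1 * restForm L t₀ z.2.1 z.2.2 := by
    filter_upwards [(continuous_snd (X := ℝ) (Y := E × E)).continuousAt.eventually (hUv v)]
      with y hy
    rw [canonicalLagrangian, hrest t₀ ht₀ _ hy]
  have e2 : (fun z : ℝ × E × E => kineticPart C z.2) =ᶠ[𝓝 (t₀, x, v)]
      fun z => L z - affinePart L z := by
    filter_upwards [(continuous_snd (X := ℝ) (Y := E × E)).continuousAt.eventually (hUv v),
      (hJ.preimage continuous_fst).mem_nhds ht₀] with y hy ht
    exact kineticPart_eq hL hC ht hy y.2.2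
  -- `L` is available only on `J`, but `t` is arbitrary: as `K` is autonomous, its expression is
  -- moved from `t` to `t₀`, where `K` is `L` minus its affine part. The affine part subtracts `β`,
  -- and `-t β` restores it.
  rw [elForm_congr e1, elForm_sub (hK' t) hb', elForm_autonomous hK,
    ← elForm_autonomous hK t₀, elForm_congr e2,
    elForm_sub (hL t₀ ht₀ x hx v) (contDiffAt_affinePart (hL t₀ ht₀ x hx 0) v),
    elForm_affinePart (hL t₀ ht₀ x hx 0), elForm_time_mul hb, hsymm t₀ ht₀ u v, hclosed u v,
    elForm_rest (hL t₀ ht₀ x hx 0), hC t₀ ht₀ x hx]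
  ring

end Local

end Calculus

/-! ### Changes of charts on `M`, `T¹M` and `T²M` -/

section Transition

/-- The coordinate change of `TM` induced by a map `T` between coordinate planes. -/
def tangentLift (T : Plane → Plane) (z : Plane × Plane) : Plane × Plane :=
  (T z.1, fderiv ℝ T z.1 z.2)

variable {T : Plane → Plane} {x : Plane}

theorem contDiffAt_tangentLift (hT : ContDiffAt ℝ ∞ T x) (v : Plane) :
    ContDiffAt ℝ ∞ (tangentLift T) (x, v) := by
  have h1 := hT.comp (f := fun z : Plane × Plane => z.1) (x, v) contDiffAt_fst
  have h2 := hT.fderiv_infty.comp (f := fun z : Plane × Plane => z.1) (x, v) contDiffAt_fst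
  exact h1.prodMk (h2.clm_apply contDiffAt_snd)

theorem fderiv_tangentLift (hT : ContDiffAt ℝ ∞ T x) (v : Plane) (d : Plane × Plane) :
    fderiv ℝ (tangentLift T) (x, v) d
      = (fderiv ℝ T x d.1, fderiv ℝ T x d.2 + fderiv ℝ (fderiv ℝ T) x d.1 v) := by
  have h1 := hT.differentiableAt_infty.hasFDerivAt.comp (f := fun z : Plane × Plane => z.1)
    (x, v) hasFDerivAt_fst
  have h2 := hT.fderiv_infty.differentiableAt_infty.hasFDerivAt.comp
    (f := fun z : Plane × Plane => z.1) (x, v) hasFDerivAt_fst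
  have h3 : HasFDerivAt (tangentLift T) _ (x, v) := h1.prodMk (h2.clm_apply hasFDerivAt_snd)
  rw [h3.fderiv]
  simp

variable {M : Type*} [TopologicalSpace M] {φ ψ : OpenPartialHomeomorph M Plane}

theorem transition_mem_target (hx : x ∈ (φ.symm.trans ψ).source) :
    (φ.symm.trans ψ) x ∈ ψ.target :=
  ψ.map_source hx.2

theorem symm_transition (hx : x ∈ (φ.symm.trans ψ).source) :
    ψ.symm ((φ.symm.trans ψ) x) = φ.symm x :=
  ψ.left_inv hx.2

theorem eventually_mem_transition (hx : x ∈ (φ.symm.trans ψ).source) :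
    ∀ᶠ y in 𝓝 x, y ∈ (φ.symm.trans ψ).source :=
  (φ.symm.trans ψ).open_source.mem_nhds hx

variable [ChartedSpace Plane M]

/-- The coordinates of a tangent vector in the chart associated with `φ`. -/
def tangentCoord (φ : OpenPartialHomeomorph M Plane) (w : T1 M) : Plane × Plane :=
  (φ w.proj, mfderiv (𝓡 2) (𝓡 2) φ w.proj w.2)

theorem mdifferentiableAt_symm (hφ : IsChart M φ)
    (hx : x ∈ φ.target) : MDifferentiableAt (𝓡 2) (𝓡 2) φ.symm x :=
  (contMDiffAt_symm_of_mem_maximalAtlas hφ hx).mdifferentiableAt (by simp)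

theorem mdifferentiableAt_chart (hφ : IsChart M φ)
    {q : M} (hq : q ∈ φ.source) : MDifferentiableAt (𝓡 2) (𝓡 2) φ q :=
  (contMDiffAt_of_mem_maximalAtlas hφ hq).mdifferentiableAt (by simp)

theorem contDiffAt_transition (hφ : IsChart M φ) (hψ : IsChart M ψ)
    (hx : x ∈ (φ.symm.trans ψ).source) : ContDiffAt ℝ ∞ (φ.symm.trans ψ) x := by
  have h1 : x ∈ φ.target := hx.1
  have h2 : φ.symm x ∈ ψ.source := hx.2
  have := (contMDiffAt_of_mem_maximalAtlas hψ h2).comp x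
    (contMDiffAt_symm_of_mem_maximalAtlas hφ h1)
  exact this.contDiffAt

theorem mfderiv_symm_transition (hφ : IsChart M φ) (hψ : IsChart M ψ)
    (hx : x ∈ (φ.symm.trans ψ).source) (u : Plane) :
    (mfderiv (𝓡 2) (𝓡 2) φ.symm x u : Plane)
      = mfderiv (𝓡 2) (𝓡 2) ψ.symm ((φ.symm.trans ψ) x) (fderiv ℝ (φ.symm.trans ψ) x u) := by
  have e : ψ.symm ∘ (φ.symm.trans ψ) =ᶠ[𝓝 x] φ.symm :=
    (eventually_mem_transition hx).mono fun y hy => symm_transition hy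
  have hd : MDifferentiableAt (𝓡 2) (𝓡 2) (φ.symm.trans ψ) x :=
    (contDiffAt_transition hφ hψ hx).differentiableAt_infty.mdifferentiableAt
  have k := mfderiv_comp x (mdifferentiableAt_symm hψ (transition_mem_target hx)) hd
  rw [mfderiv_eq_fderiv] at k
  exact (congrArg (fun l => (l u : Plane)) (e.mfderiv_eq (I := 𝓡 2) (I' := 𝓡 2))).symm.trans
    (congrArg (fun l => (l u : Plane)) k)

theorem chartT1_transition (hφ : IsChart M φ) (hψ : IsChart M ψ)
    (hx : x ∈ (φ.symm.trans ψ).source) (v : Plane) :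
    chartT1 φ (x, v) = chartT1 ψ (tangentLift (φ.symm.trans ψ) (x, v)) :=
  TotalSpace.ext (symm_transition hx).symm (heq_of_eq (mfderiv_symm_transition hφ hψ hx v))

theorem tangentCoord_chartT1 (hφ : IsChart M φ) (hψ : IsChart M ψ)
    (hx : x ∈ (φ.symm.trans ψ).source) (v : Plane) :
    tangentCoord ψ (chartT1 φ (x, v)) = tangentLift (φ.symm.trans ψ) (x, v) := by
  have k := mfderiv_comp x (I := 𝓡 2) (I' := 𝓡 2) (I'' := 𝓡 2)
    (mdifferentiableAt_chart hψ (q := φ.symm x) hx.2) (mdifferentiableAt_symm hφ hx.1)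
  refine Prod.ext rfl ?_
  have k2 : mfderiv (𝓡 2) (𝓡 2) (ψ ∘ φ.symm) x = fderiv ℝ (φ.symm.trans ψ) x :=
    mfderiv_eq_fderiv
  exact (congrArg (fun l => (l v : Plane)) k).symm.trans (congrArg (fun l => (l v : Plane)) k2)

theorem chartT1_tangentCoord (hφ : IsChart M φ) {w : T1 M} (hw : w.proj ∈ φ.source) :
    chartT1 φ (tangentCoord φ w) = w := by
  refine TotalSpace.ext (φ.left_inv hw) (heq_of_eq ?_)
  have k := mfderiv_comp w.proj (I := 𝓡 2) (I' := 𝓡 2) (I'' := 𝓡 2)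
    (mdifferentiableAt_symm hφ (φ.map_source hw)) (mdifferentiableAt_chart hφ hw)
  have e : φ.symm ∘ φ =ᶠ[𝓝 w.proj] id := by
    filter_upwards [φ.open_source.mem_nhds hw] with y hy using φ.left_inv hy
  have k3 := e.mfderiv_eq (I := 𝓡 2) (I' := 𝓡 2)
  rw [mfderiv_id] at k3
  exact (congrArg (fun l => (l w.2 : Plane)) k).symm.trans
    (congrArg (fun l => (l w.2 : Plane)) k3)

variable [IsManifold (𝓡 2) ∞ M]

/-- Near the point the parametrization of `T¹M` by `φ` is the one by `ψ` after the tangent lift of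
the transition map; differentiating this in the direction `(v, a)` produces the quadratic term in
the acceleration. -/
theorem chartT2_transition (hφ : IsChart M φ) (hψ : IsChart M ψ)
    (hx : x ∈ (φ.symm.trans ψ).source) (v a : Plane) :
    chartT2 hφ (x, v, a) hx.1 = chartT2 hψ ((φ.symm.trans ψ) x, fderiv ℝ (φ.symm.trans ψ) x v,
      fderiv ℝ (φ.symm.trans ψ) x a + fderiv ℝ (fderiv ℝ (φ.symm.trans ψ)) x v v)
      (transition_mem_target hx) := by
  have hT := contDiffAt_transition hφ hψ hx
  refine Subtype.ext (TotalSpace.ext (chartT1_transition hφ hψ hx v) (heq_of_eq ?_))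
  have e : chartT1 φ =ᶠ[𝓝 (x, v)] chartT1 ψ ∘ tangentLift (φ.symm.trans ψ) := by
    filter_upwards [continuousAt_fst.eventually (eventually_mem_transition hx)] with y hy
    exact chartT1_transition hφ hψ hy y.2
  have hd : MDifferentiableAt 𝓘(ℝ, Plane × Plane) 𝓘(ℝ, Plane × Plane)
      (tangentLift (φ.symm.trans ψ)) (x, v) :=
    (contDiffAt_tangentLift hT v).differentiableAt_infty.mdifferentiableAt
  have k := mfderiv_comp (x, v) (I := 𝓘(ℝ, Plane × Plane)) (I'' := (𝓡 2).tangent)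
    (mdifferentiableAt_chartT1 (z := tangentLift (φ.symm.trans ψ) (x, v)) hψ
      (transition_mem_target hx)) hd
  rw [mfderiv_eq_fderiv] at k
  have k2 := e.mfderiv_eq (I := 𝓘(ℝ, Plane × Plane)) (I' := (𝓡 2).tangent)
  have k3 := fderiv_tangentLift hT v (v, a)
  have k4 := (congrArg (fun l => (l (v, a) : Plane × Plane)) k2).trans
    (congrArg (fun l => (l (v, a) : Plane × Plane)) k)
  refine k4.trans ?_
  exact congrArg (fun d => (mfderiv 𝓘(ℝ, Plane × Plane) (𝓡 2).tangent (chartT1 ψ)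
    (tangentLift (φ.symm.trans ψ) (x, v)) d : Plane × Plane)) k3

end Transition

/-! ### A source form as a covector on second-order velocities -/

section Source

variable {M : Type*} [TopologicalSpace M] [ChartedSpace Plane M] [IsManifold (𝓡 2) ∞ M]

/-- The value of a source form at time `0` on the pair `(u, ∂/∂t)`, for `u` a tangent vector of `M`,
as a linear function of `u`. -/
def SourceForm.covector (ε : SourceForm M) (j : T2 M) : Plane →L[ℝ] ℝ :=
  ((ε.form (0, j)).toContinuousMultilinearMap.toContinuousLinearMap
    ![(0, (0 : TangentSpace (𝓡 2) j.base)), (1, 0)] 0).comp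
      (ContinuousLinearMap.inr ℝ ℝ (TangentSpace (𝓡 2) j.base))

theorem SourceForm.covector_apply (ε : SourceForm M) (j : T2 M) (u : TangentSpace (𝓡 2) j.base) :
    ε.covector j u = ε.form (0, j) ![(0, u), (1, 0)] := by
  have : Function.update ![((0 : ℝ), (0 : TangentSpace (𝓡 2) j.base)), (1, 0)] 0 (0, u)
      = ![(0, u), (1, 0)] := by
    ext k : 1
    fin_cases k <;> rfl
  exact congrArg (ε.form (0, j)) this

/-- The chart expression `∑ ε_i(x, v, a) uⁱ` of a source form. -/
def SourceForm.chartForm (ε : SourceForm M) {φ : OpenPartialHomeomorph M Plane}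
    (hφ : IsChart M φ) (x v a u : Plane) : ℝ :=
  open Classical in
  if hx : x ∈ φ.target then ε.covector (chartT2 hφ (x, v, a) hx) (mfderiv (𝓡 2) (𝓡 2) φ.symm x u)
  else 0

variable {φ ψ : OpenPartialHomeomorph M Plane} {x : Plane} (ε : SourceForm M)

theorem SourceForm.chartForm_of_mem (hφ : IsChart M φ) (hx : x ∈ φ.target) (v a u : Plane) :
    ε.chartForm hφ x v a u
      = ε.covector (chartT2 hφ (x, v, a) hx) (mfderiv (𝓡 2) (𝓡 2) φ.symm x u) :=
  dif_pos hx

theorem SourceForm.coeff_eq_chartForm (hφ : IsChart M φ) (i : Fin 2) (z : Plane × Plane × Plane) :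
    ε.coeff hφ i z = ε.chartForm hφ z.1 z.2.1 z.2.2 (e i) := by
  unfold SourceForm.coeff sourceCoeff SourceForm.chartForm
  split_ifs with h
  · exact (ε.covector_apply _ _).symm
  · rfl

theorem eq_sum_e (u : Plane) : u = u 0 • e 0 + u 1 • e 1 := by
  ext k
  fin_cases k <;> simp [e]

theorem SourceForm.chartForm_eq_sum (hφ : IsChart M φ) (x v a u : Plane) :
    ε.chartForm hφ x v a u
      = u 0 * ε.coeff hφ 0 (x, v, a) + u 1 * ε.coeff hφ 1 (x, v, a) := by
  rw [ε.coeff_eq_chartForm, ε.coeff_eq_chartForm]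
  by_cases hx : x ∈ φ.target
  · rw [ε.chartForm_of_mem hφ hx, ε.chartForm_of_mem hφ hx, ε.chartForm_of_mem hφ hx]
    have : (mfderiv (𝓡 2) (𝓡 2) φ.symm x u : Plane) = u 0 • mfderiv (𝓡 2) (𝓡 2) φ.symm x (e 0)
        + u 1 • mfderiv (𝓡 2) (𝓡 2) φ.symm x (e 1) := by
      conv_lhs => rw [eq_sum_e u]
      exact (map_add _ _ _).trans (congrArg₂ (· + ·) (map_smul _ _ _) (map_smul _ _ _))
    refine (congrArg _ this).trans ?_
    exact (map_add _ _ _).trans (congrArg₂ (· + ·) (map_smul _ _ _) (map_smul _ _ _))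
  · simp [SourceForm.chartForm, hx]

/-- Both sides evaluate one and the same covector of `M`, at one second-order velocity, on one
tangent vector; only the coordinates differ. -/
theorem SourceForm.chartForm_transition (hφ : IsChart M φ) (hψ : IsChart M ψ)
    (hx : x ∈ (φ.symm.trans ψ).source) (v a u : Plane) :
    ε.chartForm hφ x v a u = ε.chartForm hψ ((φ.symm.trans ψ) x) (fderiv ℝ (φ.symm.trans ψ) x v)
      (fderiv ℝ (φ.symm.trans ψ) x a + fderiv ℝ (fderiv ℝ (φ.symm.trans ψ)) x v v)
      (fderiv ℝ (φ.symm.trans ψ) x u) := by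
  rw [ε.chartForm_of_mem hφ hx.1, ε.chartForm_of_mem hψ (transition_mem_target hx),
    chartT2_transition hφ hψ hx]
  exact congrArg _ (mfderiv_symm_transition hφ hψ hx u)

end Source

/-! ### Compatibility of the canonical Lagrangians on overlaps -/

section Variational

variable {M : Type*} [TopologicalSpace M] [ChartedSpace Plane M] [IsManifold (𝓡 2) ∞ M]
  {φ ψ : OpenPartialHomeomorph M Plane} {x : Plane} {ε : SourceForm M}

theorem elForm_eq_sum {L : ℝ × Plane × Plane → ℝ} {t : ℝ} {v : Plane}
    (hL : ContDiffAt ℝ ∞ L (t, x, v)) (a u : Plane) :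
    elForm L t x v a u = u 0 * elForm L t x v a (e 0) + u 1 * elForm L t x v a (e 1) := by
  have h1 : ((0 : ℝ), u, (0 : Plane)) = u 0 • (0, e 0, 0) + u 1 • (0, e 1, 0) := by
    conv_lhs => rw [eq_sum_e u]
    simp
  have h2 : ((0 : ℝ), (0 : Plane), u) = u 0 • (0, 0, e 0) + u 1 • (0, 0, e 1) := by
    conv_lhs => rw [eq_sum_e u]
    simp
  rw [elForm_eq hL, elForm_eq hL, elForm_eq hL, h1, h2, map_add, map_add, map_smul, map_smul,
    map_smul, map_smul]
  simp only [smul_eq_mul]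
  ring

theorem SourceForm.LocallyVariational.exists_lagrangian (hε : ε.LocallyVariational) (q : M) :
    ∃ (χ : OpenPartialHomeomorph M Plane) (hχ : IsChart M χ) (J : Set ℝ) (t₀ : ℝ)
      (L : ℝ × Plane × Plane → ℝ), q ∈ χ.source ∧ IsOpen J ∧ t₀ ∈ J ∧
      (∀ t ∈ J, ∀ x ∈ χ.target, ∀ v, ContDiffAt ℝ ∞ L (t, x, v)) ∧
      ∀ t ∈ J, ∀ x ∈ χ.target, ∀ v a u, ε.chartForm hχ x v a u = elForm L t x v a u := by
  -- One time suffices, here `0`: the canonical Lagrangian is built from `C` alone and extends to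
  -- all times.
  obtain ⟨χ, hχ, J, L, hq, hJ, ht, hL, hC⟩ := hε 0 q
  have hL' : ∀ t ∈ J, ∀ x ∈ χ.target, ∀ v, ContDiffAt ℝ ∞ L (t, x, v) := fun t ht x hx v =>
    hL.contDiffAt ((hJ.prod (χ.open_target.prod isOpen_univ)).mem_nhds ⟨ht, hx, mem_univ v⟩)
  refine ⟨χ, hχ, J, 0, L, hq, hJ, ht, hL', fun t ht x hx v a u => ?_⟩
  rw [ε.chartForm_eq_sum, elForm_eq_sum (hL' t ht x hx v), hC t ht x hx, hC t ht x hx]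
  rfl

theorem SourceForm.fderiv_chartForm_velocity (ε : SourceForm M) (hφ : IsChart M φ)
    (hx : x ∈ φ.target) (v u w : Plane) :
    fderiv ℝ (fun v => ε.chartForm hφ x v 0 u) v w
      = u 0 * (w 0 * ε.dA hφ 0 0 (x, v) + w 1 * ε.dA hφ 0 1 (x, v))
        + u 1 * (w 0 * ε.dA hφ 1 0 (x, v) + w 1 * ε.dA hφ 1 1 (x, v)) := by
  have hd : ∀ i, DifferentiableAt ℝ (fun v => ε.A hφ i (x, v)) v := by
    intro i
    have h1 : ContDiffAt ℝ ∞ (ε.coeff hφ i) (x, v, 0) :=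
      (ε.smooth φ hφ i).contDiffAt
        ((φ.open_target.prod isOpen_univ).mem_nhds ⟨hx, mem_univ _⟩)
    have h2 : ContDiffAt ℝ ∞ (fun v : Plane => (x, v, (0 : Plane))) v := by fun_prop
    exact (h1.comp (f := fun v : Plane => (x, v, (0 : Plane))) v h2).differentiableAt_infty
  have e1 : (fun v => ε.chartForm hφ x v 0 u)
      = fun v => u 0 * ε.A hφ 0 (x, v) + u 1 * ε.A hφ 1 (x, v) := by
    funext v; exact ε.chartForm_eq_sum hφ x v 0 u
  have h3 : ∀ i, fderiv ℝ (fun v => ε.A hφ i (x, v)) v w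
      = w 0 * ε.dA hφ i 0 (x, v) + w 1 * ε.dA hφ i 1 (x, v) := by
    intro i
    conv_lhs => rw [eq_sum_e w]
    rw [map_add, map_smul, map_smul]
    rfl
  rw [e1, fderiv_fun_add ((hd 0).const_mul _) ((hd 1).const_mul _),
    fderiv_const_mul (hd 0), fderiv_const_mul (hd 1), ← h3 0, ← h3 1]
  simp

/-- Variationality supplies a Lagrangian only in some chart near each point. Affineness in the
acceleration carries over to every other chart because transition maps are affine in the
acceleration. -/
theorem SourceForm.LocallyVariational.exists_hasFDerivAt_acceleration
    (hε : ε.LocallyVariational) (hφ : IsChart M φ) (hx : x ∈ φ.target) (v u : Plane) :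
    ∃ B : Plane →L[ℝ] ℝ, ∀ a, HasFDerivAt (fun a => ε.chartForm hφ x v a u) B a := by
  obtain ⟨χ, hχ, J, t₀, L, hq, -, ht, hL, hC⟩ := hε.exists_lagrangian (φ.symm x)
  have hxχ : x ∈ (φ.symm.trans χ).source := ⟨hx, hq⟩
  set T := φ.symm.trans χ with hT
  have hy := transition_mem_target hxχ
  have h1 : (fun a => ε.chartForm hφ x v a u) = (fun a => elForm L t₀ (T x) (fderiv ℝ T x v) a
      (fderiv ℝ T x u)) ∘ fun a => fderiv ℝ T x a + fderiv ℝ (fderiv ℝ T) x v v := by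
    funext a
    rw [ε.chartForm_transition hφ hχ hxχ, hC t₀ ht _ hy]
    rfl
  have h2 := fun a => (hasFDerivAt_elForm_acceleration (hL t₀ ht _ hy (fderiv ℝ T x v))
    (fderiv ℝ T x a + fderiv ℝ (fderiv ℝ T) x v v) (fderiv ℝ T x u)).comp a
      ((fderiv ℝ T x).hasFDerivAt.add_const _)
  rw [h1]
  exact ⟨_, h2⟩

/-- The integrand uses only the scaling `s • v`, which commutes with the Jacobian, and the
derivative of `C` in the acceleration, which transforms as a bilinear form. -/
theorem kineticPart_transition (hε : ε.LocallyVariational) (hφ : IsChart M φ) (hψ : IsChart M ψ)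
    (hx : x ∈ (φ.symm.trans ψ).source) (v : Plane) :
    kineticPart (ε.chartForm hφ) (x, v)
      = kineticPart (ε.chartForm hψ) (tangentLift (φ.symm.trans ψ) (x, v)) := by
  refine intervalIntegral.integral_congr fun s _ => ?_
  set T := φ.symm.trans ψ
  obtain ⟨B, hB⟩ := hε.exists_hasFDerivAt_acceleration hψ (transition_mem_target hx)
    (fderiv ℝ T x (s • v)) (fderiv ℝ T x v)
  have h1 : (fun a => ε.chartForm hφ x (s • v) a v)
      = (fun a => ε.chartForm hψ (T x) (fderiv ℝ T x (s • v)) a (fderiv ℝ T x v))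
        ∘ fun a => fderiv ℝ T x a + fderiv ℝ (fderiv ℝ T) x (s • v) (s • v) := by
    funext a
    exact ε.chartForm_transition hφ hψ hx _ _ _
  have h2 := (hB (fderiv ℝ T x 0 + fderiv ℝ (fderiv ℝ T) x (s • v) (s • v))).comp 0
      ((fderiv ℝ T x).hasFDerivAt.add_const _)
  simp only [tangentLift, ← map_smul]
  -- The change of chart moves the base point `a = 0` by the quadratic term in the velocity; this is
  -- harmless since the derivative `B` is the same at every `a`.
  rw [h1, h2.fderiv, (hB 0).fderiv]
  rfl

/-- The quadratic term vanishes at zero velocity, so the zero second-order velocity is independent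
of the chart and `β` is a 1-form on `M`. -/
theorem SourceForm.chartForm_rest_transition (hφ : IsChart M φ) (hψ : IsChart M ψ)
    (hx : x ∈ (φ.symm.trans ψ).source) (u : Plane) :
    ε.chartForm hφ x 0 0 u
      = ε.chartForm hψ ((φ.symm.trans ψ) x) 0 0 (fderiv ℝ (φ.symm.trans ψ) x u) := by
  rw [ε.chartForm_transition hφ hψ hx]
  simp

theorem canonicalLagrangian_transition (hε : ε.LocallyVariational) (hφ : IsChart M φ)
    (hψ : IsChart M ψ) (t : ℝ) (hx : x ∈ (φ.symm.trans ψ).source) (v : Plane) :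
    canonicalLagrangian (ε.chartForm hφ) (t, x, v) = canonicalLagrangian (ε.chartForm hψ)
      (t, (φ.symm.trans ψ) x, fderiv ℝ (φ.symm.trans ψ) x v) := by
  simp only [canonicalLagrangian]
  rw [kineticPart_transition hε hφ hψ hx, SourceForm.chartForm_rest_transition hφ hψ hx]
  rfl

/-- In every chart, the canonical Lagrange function is a smooth Lagrange function for `ε`. -/
theorem SourceForm.LocallyVariational.elForm_chartForm (hε : ε.LocallyVariational)
    (hω : ∀ (φ : OpenPartialHomeomorph M Plane) (hφ : IsChart M φ),
      ∀ x ∈ φ.target, ε.dA hφ 0 1 (x, 0) - ε.dA hφ 1 0 (x, 0) = 0)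
    (hφ : IsChart M φ) (hx : x ∈ φ.target) (t : ℝ) (v : Plane) :
    ContDiffAt ℝ ∞ (kineticPart (ε.chartForm hφ)) (x, v) ∧
    ContDiffAt ℝ ∞ (fun z : Plane × Plane => ε.chartForm hφ z.1 0 0 z.2) (x, v) ∧
    ∀ a u, ε.chartForm hφ x v a u
      = elForm (canonicalLagrangian (ε.chartForm hφ)) t x v a u := by
  -- The local result applies in the chart `χ` that carries a Lagrangian; smoothness and the
  -- Euler–Lagrange equation are then pulled back to the given chart `φ`.
  obtain ⟨χ, hχ, J, t₀, L, hq, hJ, ht, hL, hC⟩ := hε.exists_lagrangian (φ.symm x)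
  have hxχ : x ∈ (φ.symm.trans χ).source := ⟨hx, hq⟩
  have hω' : ∀ x ∈ χ.target, ∀ u w, fderiv ℝ (fun v => ε.chartForm hχ x v 0 u) 0 w
      = fderiv ℝ (fun v => ε.chartForm hχ x v 0 w) 0 u := by
    intro x hx u w
    rw [ε.fderiv_chartForm_velocity hχ hx, ε.fderiv_chartForm_velocity hχ hx]
    linear_combination (u 0 * w 1 - u 1 * w 0) * hω χ hχ x hx
  have hT := contDiffAt_transition hφ hχ hxχ
  set T := φ.symm.trans χ
  obtain ⟨hK, hβ, hE⟩ := elForm_canonicalLagrangian hJ χ.open_target hL hC hω' ht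
    (transition_mem_target hxχ) t (fderiv ℝ T x v)
  have hlift := contDiffAt_tangentLift hT v
  have hev : ∀ᶠ y in 𝓝 ((x, v) : Plane × Plane), y.1 ∈ T.source :=
    continuousAt_fst.eventually (eventually_mem_transition hxχ)
  refine ⟨?_, ?_, fun a u => ?_⟩
  · exact (hK.comp (f := tangentLift T) (x, v) hlift).congr_of_eventuallyEq
      (hev.mono fun y hy => kineticPart_transition hε hφ hχ hy y.2)
  · exact (hβ.comp (f := tangentLift T) (x, v) hlift).congr_of_eventuallyEq
      (hev.mono fun y hy => SourceForm.chartForm_rest_transition hφ hχ hy y.2)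
  · have e1 : canonicalLagrangian (ε.chartForm hφ) =ᶠ[𝓝 (t, x, v)] fun z =>
        canonicalLagrangian (ε.chartForm hχ) (z.1, T z.2.1, fderiv ℝ T z.2.1 z.2.2) :=
      ((continuous_snd (X := ℝ)).continuousAt.eventually hev).mono fun y hy =>
        canonicalLagrangian_transition hε hφ hχ y.1 hy y.2.2
    have hLc : ContDiffAt ℝ ∞ (canonicalLagrangian (ε.chartForm hχ))
        (t, T x, fderiv ℝ T x v) :=
      (hK.comp (f := fun z : ℝ × Plane × Plane => z.2) (t, T x, fderiv ℝ T x v)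
        contDiffAt_snd).sub (contDiffAt_fst.mul
          (hβ.comp (f := fun z : ℝ × Plane × Plane => z.2) (t, T x, fderiv ℝ T x v)
            contDiffAt_snd))
    rw [elForm_congr e1, elForm_comp hT hLc, ← hE, ε.chartForm_transition hφ hχ hxχ]

end Variational

/-! ### Smoothness and differentials on `ℝ × T¹M` read in charts -/

section Gluing

variable {M : Type*} [TopologicalSpace M] [ChartedSpace Plane M]
  {φ ψ : OpenPartialHomeomorph M Plane} {x : Plane}

theorem mem_transition_chartAt (hx : x ∈ φ.target) :
    x ∈ (φ.symm.trans (chartAt Plane (φ.symm x))).source :=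
  ⟨hx, mem_chart_source Plane (φ.symm x)⟩

variable [IsManifold (𝓡 2) ∞ M]

theorem isChart_chartAt (q : M) : IsChart M (chartAt Plane q) :=
  IsManifold.chart_mem_maximalAtlas q

theorem contMDiffAt_tangentCoord (hφ : IsChart M φ) {w : T1 M} (hw : w.proj ∈ φ.source) :
    ContMDiffAt (𝓡 2).tangent 𝓘(ℝ, Plane × Plane) ∞ (tangentCoord φ) w := by
  have h1 : ContMDiffOn (𝓡 2) (𝓡 2) ∞ φ φ.source := contMDiffOn_of_mem_maximalAtlas hφ
  have h2 := h1.contMDiffOn_tangentMapWithin (m := ∞) (by simp) φ.open_source.uniqueMDiffOn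
  have h3 : ContMDiff (𝓡 2).tangent 𝓘(ℝ, Plane × Plane) ∞
      (fun w : TangentBundle (𝓡 2) Plane => ((w.1, w.2) : Plane × Plane)) := by
    have := contMDiff_tangentBundleModelSpaceHomeomorph (I := 𝓡 2) (n := ∞)
    rw [modelWithCornersSelf_prod]
    exact this
  have hn : TotalSpace.proj ⁻¹' φ.source ∈ 𝓝 w :=
    (φ.open_source.preimage (FiberBundle.continuous_proj Plane
      (TangentSpace (𝓡 2) : M → Type _))).mem_nhds hw
  have h4 := (h3.contMDiffAt (x := tangentMapWithin (𝓡 2) (𝓡 2) φ φ.source w)).comp w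
    (h2.contMDiffAt hn)
  refine h4.congr_of_eventuallyEq ?_
  filter_upwards [hn] with y hy
  simp only [tangentMapWithin, tangentCoord, Function.comp_apply]
  rw [mfderivWithin_of_isOpen φ.open_source hy]

theorem contMDiff_of_chartT1 {f : T1 M → ℝ}
    (h : ∀ φ : OpenPartialHomeomorph M Plane, IsChart M φ → ∀ x ∈ φ.target, ∀ v,
      ContDiffAt ℝ ∞ (f ∘ chartT1 φ) (x, v)) :
    ContMDiff (𝓡 2).tangent 𝓘(ℝ, ℝ) ∞ f := by
  intro w
  have hφ := isChart_chartAt (M := M) w.proj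
  have hw := mem_chart_source Plane w.proj
  have h1 := (h _ hφ _ ((chartAt Plane w.proj).map_source hw)
    (tangentCoord (chartAt Plane w.proj) w).2).contMDiffAt
  have h2 := h1.comp w (contMDiffAt_tangentCoord hφ hw)
  refine h2.congr_of_eventuallyEq ?_
  have hn : TotalSpace.proj ⁻¹' (chartAt Plane w.proj).source ∈ 𝓝 w :=
    ((chartAt Plane w.proj).open_source.preimage (FiberBundle.continuous_proj Plane
      (TangentSpace (𝓡 2) : M → Type _))).mem_nhds hw
  filter_upwards [hn] with y hy
  simp only [Function.comp_apply]
  rw [chartT1_tangentCoord hφ hy]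

theorem contMDiff_proj_T1 : ContMDiff (𝓡 2).tangent (𝓡 2) ∞ (TotalSpace.proj : T1 M → M) :=
  contMDiff_proj (TangentSpace (𝓡 2) : M → Type _)

theorem mdifferentiableAt_chartJ1 (hφ : IsChart M φ) {z : ℝ × Plane × Plane}
    (hz : z.2.1 ∈ φ.target) :
    MDifferentiableAt 𝓘(ℝ, ℝ × Plane × Plane) (𝓘(ℝ, ℝ).prod (𝓡 2).tangent) (chartJ1 φ) z :=
  (differentiableAt_fst.mdifferentiableAt).prodMk
    ((mdifferentiableAt_chartT1 hφ hz).comp z differentiableAt_snd.mdifferentiableAt)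

theorem mfderiv_chartJ1 (hφ : IsChart M φ) {z : ℝ × Plane × Plane} (hz : z.2.1 ∈ φ.target)
    (d : ℝ × Plane × Plane) :
    (mfderiv 𝓘(ℝ, ℝ × Plane × Plane) (𝓘(ℝ, ℝ).prod (𝓡 2).tangent) (chartJ1 φ) z d :
      ℝ × Plane × Plane)
      = (d.1, mfderiv 𝓘(ℝ, Plane × Plane) (𝓡 2).tangent (chartT1 φ) z.2 d.2) := by
  have h1 : MDifferentiableAt 𝓘(ℝ, ℝ × Plane × Plane) 𝓘(ℝ, ℝ)
      (Prod.fst : ℝ × Plane × Plane → ℝ) z := differentiableAt_fst.mdifferentiableAt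
  have h2 : MDifferentiableAt 𝓘(ℝ, ℝ × Plane × Plane) 𝓘(ℝ, Plane × Plane)
      (Prod.snd : ℝ × Plane × Plane → Plane × Plane) z := differentiableAt_snd.mdifferentiableAt
  have h3 := (mdifferentiableAt_chartT1 hφ hz).comp z h2
  have k1 := mfderiv_prodMk h1 h3
  have k2 := mfderiv_comp z (mdifferentiableAt_chartT1 hφ hz) h2
  have k3 : mfderiv 𝓘(ℝ, ℝ × Plane × Plane) 𝓘(ℝ, ℝ) (Prod.fst : ℝ × Plane × Plane → ℝ) z
      = ContinuousLinearMap.fst ℝ ℝ (Plane × Plane) := by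
    rw [mfderiv_eq_fderiv]; exact fderiv_fst
  have k4 : mfderiv 𝓘(ℝ, ℝ × Plane × Plane) 𝓘(ℝ, Plane × Plane)
      (Prod.snd : ℝ × Plane × Plane → Plane × Plane) z
      = ContinuousLinearMap.snd ℝ ℝ (Plane × Plane) := by
    rw [mfderiv_eq_fderiv]; exact fderiv_snd
  rw [k2, k3, k4] at k1
  exact congrArg (fun l => (l d : ℝ × Plane × Plane)) k1

/-- The horizontalization of a `1`-form in a chart. -/
theorem OneForm.horizontalization_chartT2 (ρ : OneForm M) (hφ : IsChart M φ) (hx : x ∈ φ.target)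
    (t : ℝ) (v a : Plane) :
    ρ.horizontalization (t, chartT2 hφ (x, v, a) hx) = ρ.inChart φ (t, x, v) (1, v, a) :=
  congrArg (fun d : ℝ × Plane × Plane => ρ (chartJ1 φ (t, x, v)) d)
    (mfderiv_chartJ1 (z := (t, x, v)) hφ hx (1, v, a)).symm

/-- The pull-back of the differential of a function on `TM` by the inverse of a chart. -/
theorem mfderiv_comp_chartJ1 {f : T1 M → ℝ} (hf : ContMDiff (𝓡 2).tangent 𝓘(ℝ, ℝ) ∞ f)
    (hφ : IsChart M φ) {z : ℝ × Plane × Plane} (hz : z.2.1 ∈ φ.target) (d : ℝ × Plane × Plane) :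
    mfderiv (𝓘(ℝ, ℝ).prod (𝓡 2).tangent) 𝓘(ℝ, ℝ) (fun p : ℝ × T1 M => f p.2) (chartJ1 φ z)
      (mfderiv 𝓘(ℝ, ℝ × Plane × Plane) (𝓘(ℝ, ℝ).prod (𝓡 2).tangent) (chartJ1 φ) z d)
      = fderiv ℝ (f ∘ chartT1 φ) z.2 d.2 := by
  have h1 : MDifferentiableAt (𝓘(ℝ, ℝ).prod (𝓡 2).tangent) 𝓘(ℝ, ℝ)
      (fun p : ℝ × T1 M => f p.2) (chartJ1 φ z) :=
    ((hf.comp contMDiff_snd).mdifferentiable (by simp)) _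
  have h2 : MDifferentiableAt 𝓘(ℝ, ℝ × Plane × Plane) 𝓘(ℝ, Plane × Plane)
      (Prod.snd : ℝ × Plane × Plane → Plane × Plane) z := differentiableAt_snd.mdifferentiableAt
  have h3 : MDifferentiableAt 𝓘(ℝ, Plane × Plane) 𝓘(ℝ, ℝ) (f ∘ chartT1 φ) z.2 :=
    (hf.mdifferentiable (by simp) _).comp _ (mdifferentiableAt_chartT1 hφ hz)
  have k1 := mfderiv_comp z h1 (mdifferentiableAt_chartJ1 hφ hz)
  have k2 := mfderiv_comp z h3 h2
  have k4 : mfderiv 𝓘(ℝ, ℝ × Plane × Plane) 𝓘(ℝ, Plane × Plane)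
      (Prod.snd : ℝ × Plane × Plane → Plane × Plane) z
      = ContinuousLinearMap.snd ℝ ℝ (Plane × Plane) := by
    rw [mfderiv_eq_fderiv]; exact fderiv_snd
  have k3 : mfderiv 𝓘(ℝ, Plane × Plane) 𝓘(ℝ, ℝ) (f ∘ chartT1 φ) z.2
      = fderiv ℝ (f ∘ chartT1 φ) z.2 := mfderiv_eq_fderiv
  rw [k4, k3] at k2
  have k5 := k1.symm.trans k2
  exact congrArg (fun l => (l d : ℝ)) k5

/-- The differential of the projection `ℝ × TM → M` in a chart. -/
theorem mfderiv_proj_chartJ1 (hφ : IsChart M φ) {z : ℝ × Plane × Plane} (hz : z.2.1 ∈ φ.target)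
    (d : ℝ × Plane × Plane) :
    (mfderiv (𝓘(ℝ, ℝ).prod (𝓡 2).tangent) (𝓡 2) (fun p : ℝ × T1 M => p.2.proj) (chartJ1 φ z)
      (mfderiv 𝓘(ℝ, ℝ × Plane × Plane) (𝓘(ℝ, ℝ).prod (𝓡 2).tangent) (chartJ1 φ) z d) : Plane)
      = mfderiv (𝓡 2) (𝓡 2) φ.symm z.2.1 d.2.1 := by
  have h1 : MDifferentiableAt (𝓘(ℝ, ℝ).prod (𝓡 2).tangent) (𝓡 2)
      (fun p : ℝ × T1 M => p.2.proj) (chartJ1 φ z) :=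
    ((contMDiff_proj_T1.comp contMDiff_snd).mdifferentiable (by simp)) _
  have h2 : HasFDerivAt (fun z : ℝ × Plane × Plane => z.2.1)
      ((ContinuousLinearMap.fst ℝ Plane Plane).comp
        (ContinuousLinearMap.snd ℝ ℝ (Plane × Plane))) z := hasFDerivAt_snd.fst
  have k1 := mfderiv_comp z h1 (mdifferentiableAt_chartJ1 hφ hz)
  have k2 := mfderiv_comp z (mdifferentiableAt_symm hφ hz)
    (I := 𝓘(ℝ, ℝ × Plane × Plane)) (f := fun z : ℝ × Plane × Plane => z.2.1)
    h2.differentiableAt.mdifferentiableAt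
  rw [mfderiv_eq_fderiv, h2.fderiv] at k2
  have k5 := k1.symm.trans k2
  exact congrArg (fun l => (l d : Plane)) k5

end Gluing

/-! ### Total derivatives as trivial second-order Lagrangians -/

section TotalDerivative

variable {E : Type*} [NormedAddCommGroup E] [NormedSpace ℝ E]

/-- The projection from second-order to first-order jets. -/
def jetProj (E : Type*) [NormedAddCommGroup E] [NormedSpace ℝ E] :
    (ℝ × E × E × E) →L[ℝ] ℝ × E × E :=
  (ContinuousLinearMap.fst ℝ ℝ (E × E × E)).prod
    (((ContinuousLinearMap.fst ℝ E (E × E)).prod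
      ((ContinuousLinearMap.fst ℝ E E).comp (ContinuousLinearMap.snd ℝ E (E × E)))).comp
        (ContinuousLinearMap.snd ℝ ℝ (E × E × E)))

theorem jetProj_apply (z : ℝ × E × E × E) : jetProj E z = (z.1, z.2.1, z.2.2.1) := rfl

/-- The direction `(1, v, a)` of the total derivative at `(t, x, v, a)`. -/
def jetDir (z : ℝ × E × E × E) : ℝ × E × E := (1, z.2.2.1, z.2.2.2)

/-- The total derivative of a function of `(t, x, v)`, as a function of `(t, x, v, a)`. -/
def totalDeriv1 (f : ℝ × E × E → ℝ) (z : ℝ × E × E × E) : ℝ :=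
  fderiv ℝ f (jetProj E z) (jetDir z)

variable {f : ℝ × E × E → ℝ} {z : ℝ × E × E × E}

theorem contDiffAt_comp_jetProj (hf : ContDiffAt ℝ ∞ f (jetProj E z)) :
    ContDiffAt ℝ ∞ (fun z => f (jetProj E z)) z :=
  hf.comp z (jetProj E).contDiff.contDiffAt

theorem fderiv_comp_jetProj (hf : DifferentiableAt ℝ f (jetProj E z)) (d : ℝ × E × E × E) :
    fderiv ℝ (fun z => f (jetProj E z)) z d = fderiv ℝ f (jetProj E z) (jetProj E d) :=
  congrArg (fun l => l d) (hf.hasFDerivAt.comp z (jetProj E).hasFDerivAt).fderiv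

theorem contDiffAt_totalDeriv1 (hf : ContDiffAt ℝ ∞ f (jetProj E z)) :
    ContDiffAt ℝ ∞ (totalDeriv1 f) z := by
  have h1 : ContDiffAt ℝ ∞ (fun z => fderiv ℝ f (jetProj E z)) z :=
    hf.fderiv_infty.comp z (jetProj E).contDiff.contDiffAt
  have h2 : ContDiffAt ℝ ∞ (jetDir (E := E)) z := by unfold jetDir; fun_prop
  exact h1.clm_apply h2

theorem fderiv_totalDeriv1 (hf : ContDiffAt ℝ ∞ f (jetProj E z)) (d : ℝ × E × E × E) :
    fderiv ℝ (totalDeriv1 f) z d = fderiv ℝ (fderiv ℝ f) (jetProj E z) (jetProj E d) (jetDir z)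
      + fderiv ℝ f (jetProj E z) (0, d.2.2.1, d.2.2.2) := by
  have h1 := hf.fderiv_infty.differentiableAt_infty.hasFDerivAt.comp z (jetProj E).hasFDerivAt
  have h2 : HasFDerivAt (jetDir (E := E)) ((0 : (ℝ × E × E × E) →L[ℝ] ℝ).prod
      ((ContinuousLinearMap.snd ℝ E (E × E)).comp (ContinuousLinearMap.snd ℝ ℝ (E × E × E)))) z :=
    (hasFDerivAt_const (1 : ℝ) z).prodMk hasFDerivAt_snd.snd
  refine (congrArg (fun l => l d) (h1.clm_apply h2).fderiv).trans ?_
  simp [add_comm]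

theorem totalDeriv1_fderiv_apply (hf : ContDiffAt ℝ ∞ f (jetProj E z)) (d : ℝ × E × E) :
    totalDeriv1 (fun y => fderiv ℝ f y d) z
      = fderiv ℝ (fderiv ℝ f) (jetProj E z) d (jetDir z) := by
  rw [totalDeriv1, fderiv_fderiv_apply hf, fderiv_fderiv_symm hf]

variable {L G : ℝ × Plane × Plane → ℝ} {H : ℝ × Plane × Plane × Plane → ℝ} {U : Set Plane}

/-- The second-order Euler–Lagrange expressions of `L + dG/dt` are the first-order ones of `L`. -/
theorem eulerLagrange2_add_totalDeriv (hU : IsOpen U)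
    (hL : ∀ t, ∀ x ∈ U, ∀ v, ContDiffAt ℝ ∞ L (t, x, v))
    (hG : ∀ t, ∀ x ∈ U, ∀ v, ContDiffAt ℝ ∞ G (t, x, v))
    (hH : ∀ z : ℝ × Plane × Plane × Plane, z.2.1 ∈ U → H z = L (jetProj Plane z) + totalDeriv1 G z)
    (i : Fin 2) (t : ℝ) {x : Plane} (hx : x ∈ U) (v a b c : Plane) :
    eulerLagrange2 H i (t, x, v, a, b, c) = elForm L t x v a (e i) := by
  have hL' : ∀ {z : ℝ × Plane × Plane × Plane}, z.2.1 ∈ U → ContDiffAt ℝ ∞ L (jetProj Plane z) :=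
    fun {z} hz => hL _ _ hz _
  have hG' : ∀ {z : ℝ × Plane × Plane × Plane}, z.2.1 ∈ U → ContDiffAt ℝ ∞ G (jetProj Plane z) :=
    fun {z} hz => hG _ _ hz _
  have hop : ∀ {z : ℝ × Plane × Plane × Plane}, z.2.1 ∈ U → ∀ᶠ y in 𝓝 z, y.2.1 ∈ U :=
    fun {z} hz => (hU.preimage (continuous_fst.comp continuous_snd)).mem_nhds hz
  have hdH : ∀ z : ℝ × Plane × Plane × Plane, z.2.1 ∈ U → ∀ d, fderiv ℝ H z d
      = fderiv ℝ L (jetProj Plane z) (jetProj Plane d)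
        + (totalDeriv1 (fun y => fderiv ℝ G y (jetProj Plane d)) z
        + fderiv ℝ G (jetProj Plane z) (0, d.2.2.1, d.2.2.2)) := by
    intro z hz d
    have e1 : H =ᶠ[𝓝 z] fun z => L (jetProj Plane z) + totalDeriv1 G z :=
      (hop hz).mono fun y hy => hH y hy
    rw [e1.fderiv_eq, fderiv_fun_add (contDiffAt_comp_jetProj (hL' hz)).differentiableAt_infty
      (contDiffAt_totalDeriv1 (hG' hz)).differentiableAt_infty, add_apply,
      fderiv_comp_jetProj (hL' hz).differentiableAt_infty, fderiv_totalDeriv1 (hG' hz),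
      totalDeriv1_fderiv_apply (hG' hz)]
  set u := e i
  set Gv : ℝ × Plane × Plane → ℝ := fun y => fderiv ℝ G y (0, 0, u) with hGv
  set Gx : ℝ × Plane × Plane → ℝ := fun y => fderiv ℝ G y (0, u, 0) with hGx
  set Lv : ℝ × Plane × Plane → ℝ := fun y => fderiv ℝ L y (0, 0, u)
  have sm : ∀ {f : ℝ × Plane × Plane → ℝ} {y}, ContDiffAt ℝ ∞ f y → ∀ d,
      ContDiffAt ℝ ∞ (fun y => fderiv ℝ f y d) y := fun h d =>
    h.fderiv_infty.clm_apply contDiffAt_const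
  have hz : ((t, x, v, a) : ℝ × Plane × Plane × Plane).2.1 ∈ U := hx
  -- For `dG/dt` the derivatives in acceleration, velocity and position are `G_v`, `d/dt G_v + G_x`
  -- and `d/dt G_x`. In the alternating sum of their total derivatives everything cancels.
  have k0 : ∀ z : ℝ × Plane × Plane × Plane, z.2.1 ∈ U → fderiv ℝ H z (0, 0, 0, u)
      = Gv (jetProj Plane z) := by
    intro z hz
    have : jetProj Plane (0, 0, 0, u) = 0 := rfl
    simp [hdH z hz, this, totalDeriv1, hGv]
  have k1 : ∀ z : ℝ × Plane × Plane × Plane, z.2.1 ∈ U → fderiv ℝ H z (0, 0, u, 0)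
      = Lv (jetProj Plane z) + (totalDeriv1 Gv z + Gx (jetProj Plane z)) :=
    fun z hz => hdH z hz _
  have k2 : fderiv ℝ H (t, x, v, a) (0, u, 0, 0) = fderiv ℝ L (t, x, v) (0, u, 0)
      + totalDeriv1 Gx (t, x, v, a) := by
    have h0 : ((0 : ℝ), (0 : Plane), (0 : Plane)) = 0 := rfl
    have := hdH _ hz (0, u, 0, 0)
    simp only [h0, map_zero, add_zero] at this
    exact this
  have t2 : ∀ w : ℝ × Plane × Plane × Plane × Plane, w.2.1 ∈ U →
      totalDeriv2 (fun y => fderiv ℝ H y (0, 0, 0, u)) w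
        = totalDeriv1 Gv (w.1, w.2.1, w.2.2.1, w.2.2.2.1) := by
    rintro ⟨t, x, v, a, b⟩ hw
    have hz : ((t, x, v, a) : ℝ × Plane × Plane × Plane).2.1 ∈ U := hw
    have e1 : (fun y => fderiv ℝ H y (0, 0, 0, u)) =ᶠ[𝓝 (t, x, v, a)]
        fun z => Gv (jetProj Plane z) := (hop hz).mono k0
    simp only [totalDeriv2]
    rw [e1.fderiv_eq, fderiv_comp_jetProj (sm (hG' hz) _).differentiableAt_infty]
    rfl
  -- As `∂H/∂a` is a function of `(t, x, v)` only, its first total derivative does not involve `b`;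
  -- it factors through the projection `P`, and the fourth-order coordinate `c` drops out.
  have t3 : totalDeriv3 (totalDeriv2 (fun y => fderiv ℝ H y (0, 0, 0, u))) (t, x, v, a, b, c)
      = fderiv ℝ (totalDeriv1 Gv) (t, x, v, a) (1, v, a, b) := by
    let P : (ℝ × Plane × Plane × Plane × Plane) →L[ℝ] ℝ × Plane × Plane × Plane :=
      (ContinuousLinearMap.fst ℝ ℝ _).prod
        (((ContinuousLinearMap.fst ℝ Plane _).prod (((ContinuousLinearMap.fst ℝ Plane _).prod
          ((ContinuousLinearMap.fst ℝ Plane Plane).comp (ContinuousLinearMap.snd ℝ Plane _))).comp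
            (ContinuousLinearMap.snd ℝ Plane (Plane × Plane × Plane)))).comp
              (ContinuousLinearMap.snd ℝ ℝ (Plane × Plane × Plane × Plane)))
    have e1 : totalDeriv2 (fun y => fderiv ℝ H y (0, 0, 0, u)) =ᶠ[𝓝 (t, x, v, a, b)]
        totalDeriv1 Gv ∘ P := by
      have : ∀ᶠ w in 𝓝 ((t, x, v, a, b) : ℝ × Plane × Plane × Plane × Plane), w.2.1 ∈ U :=
        (hU.preimage (continuous_fst.comp continuous_snd)).mem_nhds hx
      exact this.mono t2
    have hd : DifferentiableAt ℝ (totalDeriv1 Gv) (P (t, x, v, a, b)) :=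
      (contDiffAt_totalDeriv1 (z := (t, x, v, a)) (sm (hG' hz) _)).differentiableAt_infty
    simp only [totalDeriv3]
    rw [e1.fderiv_eq, fderiv_comp _ hd P.differentiableAt, P.fderiv]
    rfl
  have t4 : totalDeriv2 (fun y => fderiv ℝ H y (0, 0, u, 0)) (t, x, v, a, b)
      = totalDeriv1 Lv (t, x, v, a) + (fderiv ℝ (totalDeriv1 Gv) (t, x, v, a) (1, v, a, b)
        + totalDeriv1 Gx (t, x, v, a)) := by
    have e1 : (fun y => fderiv ℝ H y (0, 0, u, 0)) =ᶠ[𝓝 (t, x, v, a)] fun z =>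
        Lv (jetProj Plane z) + (totalDeriv1 Gv z + Gx (jetProj Plane z)) := (hop hz).mono k1
    have d1 : ContDiffAt ℝ ∞ Lv (jetProj Plane (t, x, v, a)) := sm (hL' hz) (0, 0, u)
    have d2 : ContDiffAt ℝ ∞ Gv (jetProj Plane (t, x, v, a)) := sm (hG' hz) (0, 0, u)
    have d3 : ContDiffAt ℝ ∞ Gx (jetProj Plane (t, x, v, a)) := sm (hG' hz) (0, u, 0)
    have d4 := (contDiffAt_totalDeriv1 d2).differentiableAt_infty
    have d5 := (contDiffAt_comp_jetProj d3).differentiableAt_infty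
    simp only [totalDeriv2]
    rw [e1.fderiv_eq, fderiv_fun_add (contDiffAt_comp_jetProj d1).differentiableAt_infty
      (d4.fun_add d5), fderiv_fun_add d4 d5, add_apply, add_apply,
      fderiv_comp_jetProj d1.differentiableAt_infty, fderiv_comp_jetProj d3.differentiableAt_infty]
    rfl
  have t5 : elForm L t x v a u = fderiv ℝ L (t, x, v) (0, u, 0) - totalDeriv1 Lv (t, x, v, a) := rfl
  simp only [eulerLagrange2]
  rw [t3, t4, t5, k2]
  ring

end TotalDerivative

/-! ### The global functions `K`, `β` and `E`, and the first-order Lagrangian -/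

section Global

variable {M : Type*} [TopologicalSpace M] [ChartedSpace Plane M] [IsManifold (𝓡 2) ∞ M]
  {φ ψ : OpenPartialHomeomorph M Plane} {x : Plane} {ε : SourceForm M}

/-- The function on `TM` defined by a family of chart expressions. -/
def glue (f : ∀ φ : OpenPartialHomeomorph M Plane, IsChart M φ → Plane × Plane → ℝ)
    (w : T1 M) : ℝ :=
  f _ (isChart_chartAt w.proj) (tangentCoord (chartAt Plane w.proj) w)

/-- A family of chart expressions is compatible with the changes of charts. -/
def IsCompatible (f : ∀ φ : OpenPartialHomeomorph M Plane, IsChart M φ → Plane × Plane → ℝ) :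
    Prop :=
  ∀ (φ ψ : OpenPartialHomeomorph M Plane) (hφ : IsChart M φ) (hψ : IsChart M ψ),
    ∀ x ∈ (φ.symm.trans ψ).source, ∀ v,
      f φ hφ (x, v) = f ψ hψ (tangentLift (φ.symm.trans ψ) (x, v))

theorem IsCompatible.glue_chartT1
    {f : ∀ φ : OpenPartialHomeomorph M Plane, IsChart M φ → Plane × Plane → ℝ}
    (hf : IsCompatible f) (hφ : IsChart M φ) (hx : x ∈ φ.target) (v : Plane) :
    glue f (chartT1 φ (x, v)) = f φ hφ (x, v) := by
  have h := isChart_chartAt (M := M) (φ.symm x)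
  rw [hf φ _ hφ h x (mem_transition_chartAt hx),
    ← tangentCoord_chartT1 hφ h (mem_transition_chartAt hx)]
  rfl

theorem IsCompatible.glue_comp_chartT1
    {f : ∀ φ : OpenPartialHomeomorph M Plane, IsChart M φ → Plane × Plane → ℝ}
    (hf : IsCompatible f) (hφ : IsChart M φ) (hx : x ∈ φ.target) (v : Plane) :
    glue f ∘ chartT1 φ =ᶠ[𝓝 (x, v)] f φ hφ := by
  filter_upwards [continuousAt_fst.eventually (φ.open_target.mem_nhds hx)] with y hy
  exact hf.glue_chartT1 hφ hy y.2

theorem IsCompatible.contMDiff_glue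
    {f : ∀ φ : OpenPartialHomeomorph M Plane, IsChart M φ → Plane × Plane → ℝ}
    (hf : IsCompatible f)
    (hs : ∀ (φ : OpenPartialHomeomorph M Plane) (hφ : IsChart M φ), ∀ x ∈ φ.target, ∀ v,
      ContDiffAt ℝ ∞ (f φ hφ) (x, v)) :
    ContMDiff (𝓡 2).tangent 𝓘(ℝ, ℝ) ∞ (glue f) :=
  contMDiff_of_chartT1 fun φ hφ x hx v =>
    (hs φ hφ x hx v).congr_of_eventuallyEq (hf.glue_comp_chartT1 hφ hx v)

/-- The curvature of the acceleration-free part of `ε` vanishes at zero velocity. -/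
def SourceForm.IsFlatAtRest (ε : SourceForm M) : Prop :=
  ∀ (φ : OpenPartialHomeomorph M Plane) (hφ : IsChart M φ),
    ∀ x ∈ φ.target, ε.dA hφ 0 1 (x, 0) - ε.dA hφ 1 0 (x, 0) = 0

theorem contDiffAt_kineticPart (hε : ε.LocallyVariational) (hω : ε.IsFlatAtRest)
    (hφ : IsChart M φ) (hx : x ∈ φ.target) (v : Plane) :
    ContDiffAt ℝ ∞ (kineticPart (ε.chartForm hφ)) (x, v) :=
  (hε.elForm_chartForm hω hφ hx 0 v).1

/-- The linear form `C(x, 0, 0)`. -/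
def SourceForm.restCovector (ε : SourceForm M) (hφ : IsChart M φ) (x : Plane) : Plane →L[ℝ] ℝ :=
  ε.coeff hφ 0 (x, 0, 0) • EuclideanSpace.proj 0 + ε.coeff hφ 1 (x, 0, 0) • EuclideanSpace.proj 1

theorem SourceForm.restCovector_apply (ε : SourceForm M) (hφ : IsChart M φ) (x u : Plane) :
    ε.restCovector hφ x u = ε.chartForm hφ x 0 0 u := by
  rw [ε.chartForm_eq_sum]
  simp [SourceForm.restCovector, mul_comm]

theorem SourceForm.contDiffAt_restCovector (ε : SourceForm M) (hφ : IsChart M φ)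
    (hx : x ∈ φ.target) : ContDiffAt ℝ ∞ (ε.restCovector hφ) x := by
  have h : ∀ i, ContDiffAt ℝ ∞ (fun x => ε.coeff hφ i (x, 0, 0)) x := by
    intro i
    have h1 : ContDiffAt ℝ ∞ (ε.coeff hφ i) (x, 0, 0) :=
      (ε.smooth φ hφ i).contDiffAt ((φ.open_target.prod isOpen_univ).mem_nhds ⟨hx, mem_univ _⟩)
    exact h1.comp (f := fun x : Plane => (x, (0 : Plane), (0 : Plane))) x (by fun_prop)
  exact ((h 0).smul contDiffAt_const).add ((h 1).smul contDiffAt_const)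

/-- This is the canonical Lagrangian at time `0`, where `-t β(v)` contributes exactly `β`. All
dependence of `ε` on velocity and acceleration thus comes from `K`. -/
theorem chartForm_eq_kinetic (hε : ε.LocallyVariational) (hω : ε.IsFlatAtRest)
    (hφ : IsChart M φ) (hx : x ∈ φ.target) (v a u : Plane) :
    ε.chartForm hφ x v a u
      = elForm (fun z => kineticPart (ε.chartForm hφ) z.2) 0 x v a u
        + ε.chartForm hφ x 0 0 u := by
  obtain ⟨hK, -, hE⟩ := hε.elForm_chartForm hω hφ hx 0 v
  have hb := ε.contDiffAt_restCovector hφ hx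
  have hK' : ContDiffAt ℝ ∞ (fun z : ℝ × Plane × Plane => kineticPart (ε.chartForm hφ) z.2)
      (0, x, v) := hK.comp (f := fun z : ℝ × Plane × Plane => z.2) (0, x, v) contDiffAt_snd
  have hb' : ContDiffAt ℝ ∞
      (fun z : ℝ × Plane × Plane => z.1 * ε.restCovector hφ z.2.1 z.2.2) (0, x, v) :=
    contDiffAt_fst.mul ((hb.comp (f := fun z : ℝ × Plane × Plane => z.2.1) (0, x, v)
      (by fun_prop)).clm_apply (by fun_prop))
  have e : canonicalLagrangian (ε.chartForm hφ) = fun z => kineticPart (ε.chartForm hφ) z.2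
      - z.1 * ε.restCovector hφ z.2.1 z.2.2 := by
    funext z
    rw [canonicalLagrangian, ε.restCovector_apply]
  rw [hE, e, elForm_sub hK' hb', elForm_time_mul hb, ε.restCovector_apply]
  ring

theorem isCompatible_kineticPart (hε : ε.LocallyVariational) :
    IsCompatible fun _ hφ => kineticPart (ε.chartForm hφ) :=
  fun _ _ hφ hψ _ hx v => kineticPart_transition hε hφ hψ hx v

theorem isCompatible_rest :
    IsCompatible fun _ hφ z => ε.chartForm hφ z.1 0 0 z.2 :=
  fun _ _ hφ hψ _ hx v => SourceForm.chartForm_rest_transition hφ hψ hx v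

/-- Vertical vectors are mapped to vertical vectors by the Jacobian alone, without second
derivatives of the transition map. Hence the momentum `K_v` is a covector and `K_v dx` a global
form. -/
theorem momentum_transition (hε : ε.LocallyVariational) (hω : ε.IsFlatAtRest)
    (hφ : IsChart M φ) (hψ : IsChart M ψ) (hx : x ∈ (φ.symm.trans ψ).source) (v u : Plane) :
    fderiv ℝ (kineticPart (ε.chartForm hφ)) (x, v) (0, u)
      = fderiv ℝ (kineticPart (ε.chartForm hψ)) (tangentLift (φ.symm.trans ψ) (x, v))
        (0, fderiv ℝ (φ.symm.trans ψ) x u) := by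
  have hT := contDiffAt_transition hφ hψ hx
  have e : kineticPart (ε.chartForm hφ) =ᶠ[𝓝 (x, v)]
      kineticPart (ε.chartForm hψ) ∘ tangentLift (φ.symm.trans ψ) := by
    filter_upwards [continuousAt_fst.eventually (eventually_mem_transition hx)] with y hy
    exact kineticPart_transition hε hφ hψ hy y.2
  rw [e.fderiv_eq, fderiv_comp (x, v)
    (contDiffAt_kineticPart hε hω hψ (transition_mem_target hx)
      (tangentLift (φ.symm.trans ψ) (x, v)).2).differentiableAt_infty
    (contDiffAt_tangentLift hT v).differentiableAt_infty, ContinuousLinearMap.comp_apply,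
    fderiv_tangentLift hT]
  simp

theorem fderiv_fibre {K : Plane × Plane → ℝ} {v : Plane} (hK : DifferentiableAt ℝ K (x, v))
    (u : Plane) : fderiv ℝ (fun v => K (x, v)) v u = fderiv ℝ K (x, v) (0, u) := by
  have h : HasFDerivAt (fun v : Plane => (x, v)) (ContinuousLinearMap.inr ℝ Plane Plane) v :=
    ((hasFDerivAt_const x v).prodMk (hasFDerivAt_id v)).congr_fderiv rfl
  exact congrArg (fun l => l u) (hK.hasFDerivAt.comp v h).fderiv

/-- The linear term of `K` vanishes in a chart that carries a Lagrangian, and the momentum at rest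
transforms linearly. -/
theorem momentum_zero (hε : ε.LocallyVariational) (hω : ε.IsFlatAtRest)
    (hφ : IsChart M φ) (hx : x ∈ φ.target) (u : Plane) :
    fderiv ℝ (kineticPart (ε.chartForm hφ)) (x, 0) (0, u) = 0 := by
  obtain ⟨χ, hχ, J, t₀, L, hq, hJ, ht, hL, hC⟩ := hε.exists_lagrangian (φ.symm x)
  have hxχ : x ∈ (φ.symm.trans χ).source := ⟨hx, hq⟩
  have hy := transition_mem_target hxχ
  rw [momentum_transition hε hω hφ hχ hxχ]
  simp only [tangentLift, map_zero]
  rw [← fderiv_fibre (contDiffAt_kineticPart hε hω hχ hy 0).differentiableAt_infty,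
    fderiv_kineticPart_zero hL hC ht hy]
  rfl

/-- The energy `v ∂K/∂v - K` of the kinetic part of the canonical Lagrange function. -/
def chartEnergy (C : Plane → Plane → Plane → Plane → ℝ) (z : Plane × Plane) : ℝ :=
  fderiv ℝ (kineticPart C) z (0, z.2) - kineticPart C z

theorem contDiffAt_chartEnergy (hε : ε.LocallyVariational) (hω : ε.IsFlatAtRest)
    (hφ : IsChart M φ) (hx : x ∈ φ.target) (v : Plane) :
    ContDiffAt ℝ ∞ (chartEnergy (ε.chartForm hφ)) (x, v) :=
  ((contDiffAt_kineticPart hε hω hφ hx v).fderiv_infty.clm_apply (by fun_prop)).sub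
    (contDiffAt_kineticPart hε hω hφ hx v)

theorem fderiv_chartEnergy (hε : ε.LocallyVariational) (hω : ε.IsFlatAtRest)
    (hφ : IsChart M φ) (hx : x ∈ φ.target) (v : Plane) (ξ η : Plane) :
    fderiv ℝ (chartEnergy (ε.chartForm hφ)) (x, v) (ξ, η)
      = fderiv ℝ (fderiv ℝ (kineticPart (ε.chartForm hφ))) (x, v) (ξ, η) (0, v)
        - fderiv ℝ (kineticPart (ε.chartForm hφ)) (x, v) (ξ, 0) := by
  have hK := contDiffAt_kineticPart hε hω hφ hx v
  have h1 : HasFDerivAt (fun z : Plane × Plane => ((0 : Plane), z.2))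
      ((0 : (Plane × Plane) →L[ℝ] Plane).prod (ContinuousLinearMap.snd ℝ Plane Plane)) (x, v) :=
    (hasFDerivAt_const 0 (x, v)).prodMk hasFDerivAt_snd
  have h2 := (hK.fderiv_infty.differentiableAt_infty.hasFDerivAt.clm_apply h1).sub
    hK.differentiableAt_infty.hasFDerivAt
  refine (congrArg (fun l => l (ξ, η)) h2.fderiv).trans ?_
  have h3 : ((ξ, η) : Plane × Plane) = (ξ, 0) + (0, η) := by simp
  have h4 : ((0 : Plane), (0 : Plane)) = 0 := rfl
  simp only [h3, map_add]
  simp [h4]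
  ring

/-- The energy pairs the momentum, a covector, with the velocity, a vector, and subtracts the scalar
`K`. -/
theorem isCompatible_chartEnergy (hε : ε.LocallyVariational) (hω : ε.IsFlatAtRest) :
    IsCompatible fun _ hφ => chartEnergy (ε.chartForm hφ) := by
  intro φ ψ hφ hψ x hx v
  simp only [chartEnergy]
  rw [momentum_transition hε hω hφ hψ hx, kineticPart_transition hε hφ hψ hx]
  rfl

/-- The autonomous part of the global Lagrangian, a function on `TM`. -/
def SourceForm.kinetic (ε : SourceForm M) : T1 M → ℝ :=
  glue fun _ hφ => kineticPart (ε.chartForm hφ)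

/-- The value of `ε` at rest on a tangent vector. -/
def SourceForm.rest (ε : SourceForm M) : T1 M → ℝ :=
  glue fun _ hφ z => ε.chartForm hφ z.1 0 0 z.2

/-- The energy of the autonomous part of the global Lagrangian. -/
def SourceForm.energy (ε : SourceForm M) : T1 M → ℝ :=
  glue fun _ hφ => chartEnergy (ε.chartForm hφ)

theorem globallyVariational (hε : ε.LocallyVariational) (hω : ε.IsFlatAtRest) :
    ε.GloballyVariational := by
  refine ⟨fun p => ε.kinetic p.2 - p.1 * ε.rest p.2, ?_, ?_⟩
  · have h1 := (isCompatible_kineticPart hε).contMDiff_glue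
      fun φ hφ x hx v => contDiffAt_kineticPart hε hω hφ hx v
    have h2 := (isCompatible_rest (ε := ε)).contMDiff_glue
      fun φ hφ x hx v => (hε.elForm_chartForm hω hφ hx 0 v).2.1
    exact (h1.comp contMDiff_snd).sub (contMDiff_fst.mul (h2.comp contMDiff_snd))
  · intro φ hφ t x hx v a i
    have e : chartFun1 φ (fun p => ε.kinetic p.2 - p.1 * ε.rest p.2) =ᶠ[𝓝 (t, x, v)]
        canonicalLagrangian (ε.chartForm hφ) := by
      have : ∀ᶠ z in 𝓝 ((t, x, v) : ℝ × Plane × Plane), z.2.1 ∈ φ.target :=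
        (φ.open_target.preimage (continuous_fst.comp continuous_snd)).mem_nhds hx
      filter_upwards [this] with z hz
      exact congrArg₂ (fun r s => r - z.1 * s)
        ((isCompatible_kineticPart hε).glue_chartT1 hφ hz z.2.2)
        ((isCompatible_rest (ε := ε)).glue_chartT1 hφ hz z.2.2)
    rw [ε.coeff_eq_chartForm, (hε.elForm_chartForm hω hφ hx t v).2.2, ← elForm_congr e]
    rfl

end Global

/-! ### The forms `μ₀` and `κ`, their chart formulas, and the second-order Lagrangian -/

section Forms

variable {M : Type*} [TopologicalSpace M] [ChartedSpace Plane M] [IsManifold (𝓡 2) ∞ M]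
  {φ ψ : OpenPartialHomeomorph M Plane} {x : Plane} {ε : SourceForm M}

/-- The velocity coordinates, in the preferred chart at the base point, of the projection of a
tangent vector of `ℝ × TM` to `M`. -/
def projCoord (p : ℝ × T1 M) :
    TangentSpace (𝓘(ℝ, ℝ).prod (𝓡 2).tangent) p →L[ℝ] Plane :=
  (mfderiv (𝓡 2) (𝓡 2) (chartAt Plane p.2.proj) p.2.proj).comp
    (mfderiv (𝓘(ℝ, ℝ).prod (𝓡 2).tangent) (𝓡 2) (fun p : ℝ × T1 M => p.2.proj) p)

theorem projCoord_chartJ1 (hφ : IsChart M φ) {z : ℝ × Plane × Plane} (hz : z.2.1 ∈ φ.target)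
    (d : ℝ × Plane × Plane) :
    projCoord (chartJ1 φ z)
      (mfderiv 𝓘(ℝ, ℝ × Plane × Plane) (𝓘(ℝ, ℝ).prod (𝓡 2).tangent) (chartJ1 φ) z d)
      = fderiv ℝ (φ.symm.trans (chartAt Plane (φ.symm z.2.1))) z.2.1 d.2.1 := by
  have k := tangentCoord_chartT1 hφ (isChart_chartAt (M := M) (φ.symm z.2.1))
    (mem_transition_chartAt hz) d.2.1
  refine Eq.trans ?_ (congrArg Prod.snd k)
  exact congrArg (fun u : Plane => (mfderiv (𝓡 2) (𝓡 2) (chartAt Plane (φ.symm z.2.1))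
    (φ.symm z.2.1) u : Plane)) (mfderiv_proj_chartJ1 hφ hz d)

/-- The global form `κ`: the vertical derivative of the kinetic part. -/
def SourceForm.kappa (ε : SourceForm M) : OneForm M := fun p =>
  ((fderiv ℝ (kineticPart (ε.chartForm (isChart_chartAt p.2.proj)))
    (tangentCoord (chartAt Plane p.2.proj) p.2)).comp
      (ContinuousLinearMap.inr ℝ Plane Plane)).comp (projCoord p)

/-- The differential of a function on `TM`, as a form on `ℝ × TM`. -/
def differential (f : T1 M → ℝ) : OneForm M := fun p =>
  mfderiv (𝓘(ℝ, ℝ).prod (𝓡 2).tangent) 𝓘(ℝ, ℝ) (fun p : ℝ × T1 M => f p.2) p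

/-- The global form `μ₀ = t (dE - β)`. -/
def SourceForm.muZero (ε : SourceForm M) : OneForm M := fun p =>
  p.1 • (differential ε.energy p
    - (ε.restCovector (isChart_chartAt p.2.proj) (chartAt Plane p.2.proj p.2.proj)).comp
      (projCoord p))

/-- The form is defined through the preferred chart at each base point; covariance of the momentum
removes this choice. -/
theorem inChart_kappa (hε : ε.LocallyVariational) (hω : ε.IsFlatAtRest) (hφ : IsChart M φ)
    {z : ℝ × Plane × Plane} (hz : z.2.1 ∈ φ.target) (d : ℝ × Plane × Plane) :
    OneForm.inChart ε.kappa φ z d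
      = fderiv ℝ (kineticPart (ε.chartForm hφ)) z.2 (0, d.2.1) := by
  have hx := mem_transition_chartAt hz
  have hψ := isChart_chartAt (M := M) (φ.symm z.2.1)
  rw [momentum_transition hε hω hφ hψ hx, ← tangentCoord_chartT1 hφ hψ hx,
    ← projCoord_chartJ1 hφ hz]
  rfl

theorem inChart_muZero (hε : ε.LocallyVariational) (hω : ε.IsFlatAtRest) (hφ : IsChart M φ)
    {z : ℝ × Plane × Plane} (hz : z.2.1 ∈ φ.target) (d : ℝ × Plane × Plane) :
    OneForm.inChart ε.muZero φ z d
      = z.1 * (fderiv ℝ (chartEnergy (ε.chartForm hφ)) z.2 d.2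
        - ε.restCovector hφ z.2.1 d.2.1) := by
  have hx := mem_transition_chartAt hz
  have hψ := isChart_chartAt (M := M) (φ.symm z.2.1)
  have hE := (isCompatible_chartEnergy hε hω).contMDiff_glue
      fun φ hφ x hx v => contDiffAt_chartEnergy hε hω hφ hx v
  rw [← ((isCompatible_chartEnergy hε hω).glue_comp_chartT1 hφ hz z.2.2).fderiv_eq,
    ε.restCovector_apply, SourceForm.chartForm_rest_transition hφ hψ hx,
    ← projCoord_chartJ1 hφ hz, ← ε.restCovector_apply]
  exact congrArg (fun r : ℝ => z.1 * (r - ε.restCovector hψ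
    ((φ.symm.trans (chartAt Plane (φ.symm z.2.1))) z.2.1) (projCoord (chartJ1 φ z)
      (mfderiv 𝓘(ℝ, ℝ × Plane × Plane) (𝓘(ℝ, ℝ).prod (𝓡 2).tangent) (chartJ1 φ) z d))))
    (mfderiv_comp_chartJ1 hE hφ hz d)

theorem isSmooth_kappa (hε : ε.LocallyVariational) (hω : ε.IsFlatAtRest) :
    OneForm.IsSmooth ε.kappa := by
  intro φ hφ
  have e : ∀ z ∈ univ ×ˢ φ.target ×ˢ univ, OneForm.inChart ε.kappa φ z
      = (fderiv ℝ (kineticPart (ε.chartForm hφ)) z.2).comp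
        ((ContinuousLinearMap.inr ℝ Plane Plane).comp
          ((ContinuousLinearMap.fst ℝ Plane Plane).comp
            (ContinuousLinearMap.snd ℝ ℝ (Plane × Plane)))) := by
    intro z hz
    refine ContinuousLinearMap.ext fun d => ?_
    rw [inChart_kappa hε hω hφ hz.2.1]
    rfl
  refine ContDiffOn.congr (fun z hz => ContDiffAt.contDiffWithinAt ?_) e
  have := (contDiffAt_kineticPart hε hω hφ hz.2.1 z.2.2).fderiv_infty.comp z
    (f := fun z : ℝ × Plane × Plane => z.2) contDiffAt_snd
  exact this.clm_comp contDiffAt_const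

theorem isSmooth_muZero (hε : ε.LocallyVariational) (hω : ε.IsFlatAtRest) :
    OneForm.IsSmooth ε.muZero := by
  intro φ hφ
  have e : ∀ z ∈ univ ×ˢ φ.target ×ˢ univ, OneForm.inChart ε.muZero φ z
      = z.1 • ((fderiv ℝ (chartEnergy (ε.chartForm hφ)) z.2).comp
            (ContinuousLinearMap.snd ℝ ℝ (Plane × Plane))
          - (ε.restCovector hφ z.2.1).comp
          ((ContinuousLinearMap.fst ℝ Plane Plane).comp
            (ContinuousLinearMap.snd ℝ ℝ (Plane × Plane)))) := by
    intro z hz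
    refine ContinuousLinearMap.ext fun d => ?_
    rw [inChart_muZero hε hω hφ hz.2.1]
    rfl
  refine ContDiffOn.congr (fun z hz => ContDiffAt.contDiffWithinAt ?_) e
  have h1 := (contDiffAt_chartEnergy hε hω hφ hz.2.1 z.2.2).fderiv_infty.comp z
    (f := fun z : ℝ × Plane × Plane => z.2) contDiffAt_snd
  have h2 := (ε.contDiffAt_restCovector hφ hz.2.1).comp z
    (f := fun z : ℝ × Plane × Plane => z.2.1) (by fun_prop)
  exact contDiffAt_fst.smul ((h1.clm_comp contDiffAt_const).sub (h2.clm_comp contDiffAt_const))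

/-- Only `K` contributes to the acceleration terms, so `B` is minus the fibre Hessian of `K`; in
particular it is symmetric. -/
theorem B_eq (hε : ε.LocallyVariational) (hω : ε.IsFlatAtRest) (hφ : IsChart M φ)
    (hx : x ∈ φ.target) (i j : Fin 2) (v : Plane) :
    ε.B hφ i j (x, v)
      = - fderiv ℝ (fderiv ℝ (kineticPart (ε.chartForm hφ))) (x, v) (0, e j) (0, e i) := by
  have hK := contDiffAt_kineticPart hε hω hφ hx v
  have hK' : ContDiffAt ℝ ∞ (fun z : ℝ × Plane × Plane => kineticPart (ε.chartForm hφ) z.2)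
      (0, x, v) := hK.comp (f := fun z : ℝ × Plane × Plane => z.2) (0, x, v) contDiffAt_snd
  have h1 : (fun a => ε.coeff hφ i (x, v, a)) = fun a =>
      elForm (fun z => kineticPart (ε.chartForm hφ) z.2) 0 x v a (e i)
        + ε.chartForm hφ x 0 0 (e i) := by
    funext a
    rw [ε.coeff_eq_chartForm, chartForm_eq_kinetic hε hω hφ hx]
  simp only [SourceForm.B]
  rw [h1, fderiv_add_const, fderiv_elForm_acceleration hK',
    fderiv_fderiv_comp_snd_apply (z := (0, x, v)) hK]

/-- Along `dx`, `dE - β` equals `-A` up to a skew combination of the mixed derivatives `K_xv`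
contracted with `v`. That combination is half the skew part of `∂A/∂v`, which explains the factor
`1/2`. Along `dẋ` it is the Hessian `K_vv = -B` applied to `v`. -/
theorem isMuZero (hε : ε.LocallyVariational) (hω : ε.IsFlatAtRest) : ε.IsMuZero ε.muZero := by
  intro φ hφ t x hx v τ ξ η
  have hK := contDiffAt_kineticPart hε hω hφ hx v
  have hK' : ContDiffAt ℝ ∞ (fun z : ℝ × Plane × Plane => kineticPart (ε.chartForm hφ) z.2)
      (0, x, v) := hK.comp (f := fun z : ℝ × Plane × Plane => z.2) (0, x, v) contDiffAt_snd
  have hC : ∀ u, (fun v => ε.chartForm hφ x v 0 u) = fun v =>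
      elForm (fun z => kineticPart (ε.chartForm hφ) z.2) 0 x v 0 u
        + ε.chartForm hφ x 0 0 u := by
    intro u
    funext v
    rw [chartForm_eq_kinetic hε hω hφ hx]
  have h1 : ∀ u w, fderiv ℝ (fun v => ε.chartForm hφ x v 0 u) v w
      = fderiv ℝ (fun v => elForm (fun z => kineticPart (ε.chartForm hφ) z.2) 0 x v 0 u) v w := by
    intro u w
    rw [hC, fderiv_add_const]
  have h2 := fderiv_elForm_velocity_antisymm hK' ξ v
  rw [← h1, ← h1, ε.fderiv_chartForm_velocity hφ hx, ε.fderiv_chartForm_velocity hφ hx,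
    fderiv_fderiv_comp_snd_apply (z := (0, x, v)) hK,
    fderiv_fderiv_comp_snd_apply (z := (0, x, v)) hK] at h2
  have h3 := chartForm_eq_kinetic hε hω hφ hx v 0 ξ
  rw [elForm_autonomous hK, ε.chartForm_eq_sum] at h3
  have h4 := B_eq hε hω hφ hx (v := v)
  have h5 : fderiv ℝ (fderiv ℝ (kineticPart (ε.chartForm hφ))) (x, v) (0, η) (0, v)
      = - ((ε.B hφ 0 0 (x, v) * v 0 + ε.B hφ 0 1 (x, v) * v 1) * η 0
        + (ε.B hφ 0 1 (x, v) * v 0 + ε.B hφ 1 1 (x, v) * v 1) * η 1) := by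
    have k : ∀ u : Plane, ((0 : Plane), u) = u 0 • (0, e 0) + u 1 • (0, e 1) := by
      intro u
      conv_lhs => rw [eq_sum_e u]
      simp
    rw [h4, h4, h4, k η, k v]
    simp only [map_add, map_smul, add_apply, smul_apply, smul_eq_mul]
    rw [fderiv_fderiv_symm hK (0, e 1) (0, e 0)]
    ring
  have h6 : fderiv ℝ (fderiv ℝ (kineticPart (ε.chartForm hφ))) (x, v) (ξ, η) (0, v)
      = fderiv ℝ (fderiv ℝ (kineticPart (ε.chartForm hφ))) (x, v) (ξ, 0) (0, v)
        + fderiv ℝ (fderiv ℝ (kineticPart (ε.chartForm hφ))) (x, v) (0, η) (0, v) := by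
    rw [← add_apply, ← map_add]
    simp
  rw [inChart_muZero hε hω hφ hx, fderiv_chartEnergy hε hω hφ hx, ε.restCovector_apply, h6, h5]
  change ξ 0 * ε.A hφ 0 (x, v) + ξ 1 * ε.A hφ 1 (x, v) = _ at h3
  simp only at h2
  linear_combination t * h3 - (t / 2) * h2

/-- The momentum `K_v` is recovered by integrating its velocity derivative `-B` from rest, first
along `e 1` and then along `e 0`; it starts from zero by `momentum_zero`. -/
theorem isKappa (hε : ε.LocallyVariational) (hω : ε.IsFlatAtRest) : ε.IsKappa ε.kappa := by
  intro φ hφ t x hx v τ ξ η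
  have hK := contDiffAt_kineticPart hε hω hφ hx
  set K := kineticPart (ε.chartForm hφ) with hKdef
  have ftc : ∀ (c w : Plane) (i : Fin 2) (s : ℝ),
      ∫ ν in (0 : ℝ)..s, - fderiv ℝ (fderiv ℝ K) (x, c + ν • w) (0, w) (0, e i)
        = fderiv ℝ K (x, c) (0, e i) - fderiv ℝ K (x, c + s • w) (0, e i) := by
    intro c w i s
    have hγ : ∀ ν : ℝ, HasDerivAt (fun ν : ℝ => (x, c + ν • w)) ((0 : Plane), w) ν := by
      intro ν
      exact ((hasDerivAt_const ν x).prodMk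
        (((hasDerivAt_id ν).smul_const w).const_add c)).congr_deriv (by simp)
    have h1 : ∀ ν : ℝ, HasDerivAt (fun ν : ℝ => - fderiv ℝ K (x, c + ν • w) (0, e i))
        (- fderiv ℝ (fderiv ℝ K) (x, c + ν • w) (0, w) (0, e i)) ν := by
      intro ν
      have k : HasDerivAt (fun ν : ℝ => fderiv ℝ K (x, c + ν • w))
          (fderiv ℝ (fderiv ℝ K) (x, c + ν • w) (0, w)) ν :=
        HasFDerivAt.comp_hasDerivAt ν (l := fderiv ℝ K)
          (hK _).fderiv_infty.differentiableAt_infty.hasFDerivAt (hγ ν)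
      exact ((k.clm_apply (hasDerivAt_const ν ((0 : Plane), e i))).congr_deriv (by simp)).neg
    rw [intervalIntegral.integral_eq_sub_of_hasDerivAt (fun ν _ => h1 ν)]
    · simp
      ring
    · refine Continuous.intervalIntegrable (Continuous.neg ?_) _ _
      refine continuous_iff_continuousAt.2 fun ν => ?_
      have := (hK (c + ν • w)).fderiv_infty.fderiv_infty.continuousAt.comp
        (f := fun ν : ℝ => (x, c + ν • w)) (hγ ν).continuousAt
      exact (this.clm_apply continuousAt_const).clm_apply continuousAt_const
  have p0 : ∀ ν : ℝ, (!₂[ν, v 1] : Plane) = v 1 • e 1 + ν • e 0 := by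
    intro ν; ext k; fin_cases k <;> simp [e]
  have p1 : ∀ σ : ℝ, (!₂[0, σ] : Plane) = 0 + σ • e 1 := by
    intro ν; ext k; fin_cases k <;> simp [e]
  have hB := fun i j v => B_eq hε hω hφ hx i j v
  have hv : v 1 • e 1 + v 0 • e 0 = v := by rw [add_comm]; exact (eq_sum_e v).symm
  have i00 := ftc (v 1 • e 1) (e 0) 0 (v 0)
  have i10 := ftc (v 1 • e 1) (e 0) 1 (v 0)
  have i01 := ftc 0 (e 1) 0 (v 1)
  have i11 := ftc 0 (e 1) 1 (v 1)
  rw [hv] at i00 i10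
  rw [zero_add, momentum_zero hε hω hφ hx] at i01 i11
  have hξ : fderiv ℝ K (x, v) (0, ξ)
      = ξ 0 * fderiv ℝ K (x, v) (0, e 0) + ξ 1 * fderiv ℝ K (x, v) (0, e 1) := by
    have k : ((0 : Plane), ξ) = ξ 0 • (0, e 0) + ξ 1 • (0, e 1) := by
      conv_lhs => rw [eq_sum_e ξ]
      simp
    rw [k, map_add, map_smul, map_smul, smul_eq_mul, smul_eq_mul]
  rw [inChart_kappa hε hω hφ hx]
  simp only [hB, p0, p1]
  -- On the leg along `e 0` the `dx¹` coefficient needs `B_{10}`, whereas the formula has `B_{01}`.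
  have hs : ∀ ν : ℝ, fderiv ℝ (fderiv ℝ K) (x, v 1 • e 1 + ν • e 0) (0, e 1) (0, e 0)
      = fderiv ℝ (fderiv ℝ K) (x, v 1 • e 1 + ν • e 0) (0, e 0) (0, e 1) := fun ν =>
    fderiv_fderiv_symm (hK _) _ _
  simp only [← hKdef, hs, hξ]
  rw [i00, i10, i01, i11]
  ring

/-- The horizontalization is the canonical Lagrangian plus the total derivative of `G = t E`. -/
theorem isSecondOrderLagrangian (hε : ε.LocallyVariational) (hω : ε.IsFlatAtRest) :
    ε.IsSecondOrderLagrangian (OneForm.horizontalization (ε.muZero + ε.kappa)) := by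
  intro φ hφ
  set G : ℝ × Plane × Plane → ℝ := fun z => z.1 * chartEnergy (ε.chartForm hφ) z.2
  have hL : ∀ t, ∀ x ∈ φ.target, ∀ v,
      ContDiffAt ℝ ∞ (canonicalLagrangian (ε.chartForm hφ)) (t, x, v) := by
    intro t x hx v
    obtain ⟨h1, h2, -⟩ := hε.elForm_chartForm hω hφ hx t v
    exact (h1.comp (f := fun z : ℝ × Plane × Plane => z.2) (t, x, v) contDiffAt_snd).sub
      (contDiffAt_fst.mul (h2.comp (f := fun z : ℝ × Plane × Plane => z.2) (t, x, v)
        contDiffAt_snd))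
  have hE : ∀ t, ∀ x ∈ φ.target, ∀ v, ContDiffAt ℝ ∞
      (fun z : ℝ × Plane × Plane => chartEnergy (ε.chartForm hφ) z.2) (t, x, v) :=
    fun t x hx v => (contDiffAt_chartEnergy hε hω hφ hx v).comp
      (f := fun z : ℝ × Plane × Plane => z.2) (t, x, v) contDiffAt_snd
  have hG : ∀ t, ∀ x ∈ φ.target, ∀ v, ContDiffAt ℝ ∞ G (t, x, v) :=
    fun t x hx v => contDiffAt_fst.mul (hE t x hx v)
  -- `h μ₀` gives `t dE/dt - t β(v)` and `h κ` gives `K_v v = K + E`; the terms `E + t dE/dt` form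
  -- `dG/dt`.
  have hH : ∀ z : ℝ × Plane × Plane × Plane, z.2.1 ∈ φ.target →
      chartFun2 hφ (OneForm.horizontalization (ε.muZero + ε.kappa)) z
        = canonicalLagrangian (ε.chartForm hφ) (jetProj Plane z) + totalDeriv1 G z := by
    rintro ⟨t, x, v, a⟩ hx
    have hx' : x ∈ φ.target := hx
    have k1 : chartFun2 hφ (OneForm.horizontalization (ε.muZero + ε.kappa)) (t, x, v, a)
        = OneForm.inChart ε.muZero φ (t, x, v) (1, v, a)
          + OneForm.inChart ε.kappa φ (t, x, v) (1, v, a) :=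
      (dif_pos hx).trans (OneForm.horizontalization_chartT2 _ hφ hx' t v a)
    have k2 : totalDeriv1 G (t, x, v, a) = chartEnergy (ε.chartForm hφ) (x, v)
        + t * fderiv ℝ (chartEnergy (ε.chartForm hφ)) (x, v) (v, a) := by
      have h := (hasFDerivAt_fst (𝕜 := ℝ) (p := ((t, x, v) : ℝ × Plane × Plane))).mul
        (hE t x hx' v).differentiableAt_infty.hasFDerivAt
      refine (congrArg (fun l => l ((1 : ℝ), v, a)) h.fderiv).trans ?_
      simp only [add_apply, smul_apply, smul_eq_mul, ContinuousLinearMap.coe_fst']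
      rw [fderiv_comp_snd_apply (z := (t, x, v))
        (contDiffAt_chartEnergy hε hω hφ hx' v).differentiableAt_infty]
      ring
    rw [k1, k2, inChart_muZero hε hω hφ hx', inChart_kappa hε hω hφ hx', jetProj_apply,
      ε.restCovector_apply]
    simp only [canonicalLagrangian, chartEnergy]
    ring
  refine ⟨?_, fun t x hx v a b c i => ?_⟩
  · refine ContDiffOn.congr (fun z hz => ContDiffAt.contDiffWithinAt ?_)
      fun z hz => hH z hz.2.1
    exact (contDiffAt_comp_jetProj (hL z.1 z.2.1 hz.2.1 z.2.2.1)).add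
      (contDiffAt_totalDeriv1 (hG z.1 z.2.1 hz.2.1 z.2.2.1))
  · rw [eulerLagrange2_add_totalDeriv φ.open_target hL hG hH i t hx v a b c,
      ← (hε.elForm_chartForm hω hφ hx t v).2.2, ε.coeff_eq_chartForm]

end Forms

end GlobalVar

end

theorem mainTheorem4 {M : Type*} [TopologicalSpace M]
    [ChartedSpace GlobalVar.Plane M] [IsManifold (𝓡 2) ∞ M]
    (ε : GlobalVar.SourceForm M) (hε : ε.LocallyVariational)
    (hω : ∀ (φ : OpenPartialHomeomorph M GlobalVar.Plane) (hφ : GlobalVar.IsChart M φ),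
      ∀ x ∈ φ.target, ε.dA hφ 0 1 (x, 0) - ε.dA hφ 1 0 (x, 0) = 0) :
    ε.GloballyVariational ∧
      ∃ μ₀ κ : GlobalVar.OneForm M,
        GlobalVar.OneForm.IsSmooth μ₀ ∧ ε.IsMuZero μ₀ ∧
        GlobalVar.OneForm.IsSmooth κ ∧ ε.IsKappa κ ∧
        ε.IsSecondOrderLagrangian (GlobalVar.OneForm.horizontalization (μ₀ + κ)) :=
  ⟨GlobalVar.globallyVariational hε hω, ε.muZero, ε.kappa,
    GlobalVar.isSmooth_muZero hε hω, GlobalVar.isMuZero hε hω,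
    GlobalVar.isSmooth_kappa hε hω, GlobalVar.isKappa hε hω,
    GlobalVar.isSecondOrderLagrangian hε hω⟩
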